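/- **Setting.** Let $d\ge 1$. Operations and inequalities between vectors are componentwise, and a probability measure on $\mathbb R^d$ and its distribution function are denoted by the same symbol. Let $H_0$ be an angular probability measure, i.e. a Borel probability measure on the simplex $\mathcal S=\{w\in[0,\infty)^d:\sum_j w_j=1\}$ with $\int w_j\,H_0(dw)=1/d$ for all $j$, and let $L(x\mid H_0)=d\int_{\mathcal S}\max_j(w_jx_j)\,H_0(dw)$, $x\in[0,\infty)^d$. Let $G=G_{\vartheta_0}(\cdot\mid H_0)$ be the max-stable law with distribution function $$G(x)=\exp\{-L(-\log G_1(x_1),\dots,-\log G_d(x_d)\mid H_0)\}$$ (equal to $0$ if some $G_j(x_j)=0$), whose margins are all of one of three types: Fréchet, $G_j(x)=e^{-x^{-\rho_{0,j}}}$ for $x>0$ and $0$ for $x\le 0$; Weibull, $G_j(x)=e^{-(-x)^{\omega_{0,j}}}$ for $x<0$ and $1$ for $x\ge 0$; or Gumbel, $G_j(x)=\exp(-e^{-x})$; here $\rho_{0,j},\omega_{0,j}>0$. Let $F_0$ be a probability measure on $\mathbb R^d$ with marginal distribution functions $F_{0,j}$; put $z_{0,j}=\sup\{z:F_{0,j}(z)<1\}$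 and $F_{0,j}^{\leftarrow}(t)=\inf\{x:F_{0,j}(x)\ge t\}$. Let $(m_n)$ be block sizes with $m_n\to\infty$ as $n\to\infty$. **Condition A.** 1. $F_0$ is in the max-domain of attraction of $G$: there are $\alpha_m>0$, $\beta_m\in\mathbb R^d$ with $F_0^m(\alpha_mx+\beta_m)\to G(x)$ for all $x\in\mathbb R^d$. 2. $F_0(z)=C_0(F_{0,1}(z_1),\dots,F_{0,d}(z_d))$ for a copula $C_0$ that is $d$ times continuously differentiable on $(0,1)^d$; $L(\cdot\mid H_0)$ is $d$ times continuously differentiable on $(0,\infty)^d$; and for all $I\subset\{1,\dots,d\}$ and $x\in(0,\infty)^d$, $$\lim_{n\to\infty}\frac{\partial^{|I|}}{(\partial x_i,\,i\in I)}\,m_n\Big(C_0\big(\mathbf 1-x/m_n\big)-1\Big)=-\frac{\partial^{|I|}}{(\partial x_i,\,i\in I)}L(x\mid H_0).$$ 3. Each $F_{0,j}$ is continuous on $\mathbb R$ and continuously differentiable on $\{0<F_{0,j}<1\}$, and for every $j$: * Fréchet: $\lim_{z\to\infty} zF_{0,j}'(z)/(1-F_{0,j}(z))=\rho_{0,j}$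 and $F_{0,j}(0)=0$; * Weibull: $z_{0,j}<\infty$ and $\lim_{z\uparrow z_{0,j}}(z_{0,j}-z)F_{0,j}'(z)/(1-F_{0,j}(z))=\omega_{0,j}$; * Gumbel: $\lim_{z\uparrow z_{0,j}}\frac{F_{0,j}'(z)}{(1-F_{0,j}(z))^2}\int_z^{z_{0,j}}(1-F_{0,j}(t))\,dt=1$. **Normalised maxima.** Define the norming constants $$(a_{m,j},b_{m,j})=\begin{cases}\big(F_{0,j}^{\leftarrow}(1-1/m),\ 0\big)&\text{(Fréchet)}\\ \big(z_{0,j}-F_{0,j}^{\leftarrow}(1-1/m),\ z_{0,j}\big)&\text{(Weibull)}\\ \big(m\int_{b_{m,j}}^{z_{0,j}}(1-F_{0,j}(z))\,dz,\ F_{0,j}^{\leftarrow}(1-1/m)\big)&\text{(Gumbel)}\end{cases}$$ and let $Q_n$ be the joint law of the $n$ normalised componentwise block maxima $(M_{m_n,i}-b_{m_n})/a_{m_n}$, $i=1,\dots,n$, where $M_{m_n,1},\dots,M_{m_n,n}$ are the componentwise maxima over $n$ disjoint blocks of size $m_n$ of $nm_n$ i.i.d. random vectors with law $F_0$. Let $G^{(n)}$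 be the $n$-fold product of $G$. **Condition B.** Let $f_{m_n}$ be the Lebesgue density of $F_0^{m_n}(a_{m_n}\cdot+b_{m_n})$ and $g_{\vartheta_0}(\cdot\mid H_0)$ that of $G$. There are $n_0$ and $J_0\in(0,\infty)$ with $\sup_{n\ge n_0}\|f_{m_n}/g_{\vartheta_0}(\cdot\mid H_0)\|_\infty<J_0$ (essential supremum; the ratio is $\infty$ where only $g_{\vartheta_0}(\cdot\mid H_0)$ vanishes and $0$ where both densities vanish). **Proposition.** Under Conditions A and B, for every $c>0$ and every $c'\in(0,1)$, $Q_n$ is $e^{-cn}$-to-$n^{-1-c'}$-remotely contiguous with respect to $G^{(n)}$: for every sequence of Borel sets $E_n\subset(\mathbb R^d)^n$, $$G^{(n)}(E_n)=o(e^{-cn})\ \Longrightarrow\ Q_n(E_n)=o(n^{-1-c'})\qquad(n\to\infty).$$ -/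

import Mathlib

open MeasureTheory Filter Topology Set Asymptotics
open scoped ENNReal NNReal

noncomputable section

namespace MaxStable

/-- The mixed partial derivative `∂^{|I|} f / (∂ x_i, i ∈ I)` at `x`: the derivative of order `|I|`
evaluated at the canonical basis vectors with index in `I`. -/
def mixedPartial {d : ℕ} (I : Finset (Fin d)) (f : (Fin d → ℝ) → ℝ) (x : Fin d → ℝ) : ℝ :=
  iteratedFDeriv ℝ I.card f x (fun k => Pi.single (I.orderEmbOfFin rfl k) 1)

/-! ### Max-stable laws -/

/-- The mean constraints: a probability measure on the unit simplex is an angular measure when all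
its coordinate means equal `1 / d`. -/
def IsAngular {d : ℕ} (H : Measure (stdSimplex ℝ (Fin d))) : Prop :=
  ∀ j : Fin d, ∫ w, (w : Fin d → ℝ) j ∂H = 1 / (d : ℝ)

/-- The stable tail dependence function
`L(x | H) = d ∫ max (w_1 x_1, …, w_d x_d) H(dw)`, for `x ≥ 0`. -/
def stableTail {d : ℕ} (H : Measure (stdSimplex ℝ (Fin d))) (x : Fin d → ℝ) : ℝ :=
  (d : ℝ) * ∫ w, (⨆ j : Fin d, (w : Fin d → ℝ) j * x j) ∂H

/-- The three classes of max-stable laws, with unit scale and null location parameters; the first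
two carry the vector of shape parameters. -/
inductive MarginType (d : ℕ) where
  | frechet (ρ : Fin d → ℝ) : MarginType d
  | weibull (ω : Fin d → ℝ) : MarginType d
  | gumbel : MarginType d

/-- The shape parameters, if any, are positive. -/
def MarginType.ShapePos {d : ℕ} : MarginType d → Prop
  | .frechet ρ => ∀ j, 0 < ρ j
  | .weibull ω => ∀ j, 0 < ω j
  | .gumbel => True

/-- The `j`-th marginal distribution function of the max-stable law. -/
def marginDF {d : ℕ} : MarginType d → Fin d → ℝ → ℝ
  | .frechet ρ, j, x => if 0 < x then Real.exp (-(x ^ (-ρ j))) else 0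
  | .weibull ω, j, x => if x < 0 then Real.exp (-((-x) ^ ω j)) else 1
  | .gumbel, _, x => Real.exp (-Real.exp (-x))

/-- The extreme-value copula `exp (-L(-log u_1, …, -log u_d))`, equal to `0` when a coordinate
of `u` vanishes. -/
def evCopula {d : ℕ} (H : Measure (stdSimplex ℝ (Fin d))) (u : Fin d → ℝ) : ℝ :=
  open Classical in
  if ∀ j, 0 < u j then Real.exp (-stableTail H (fun j => -Real.log (u j))) else 0

/-- The max-stable distribution function `G_ϑ(x | H)`. -/
def maxStableDF {d : ℕ} (H : Measure (stdSimplex ℝ (Fin d))) (ty : MarginType d)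
    (x : Fin d → ℝ) : ℝ :=
  evCopula H (fun j => marginDF ty j (x j))

/-- The measure `G` is the law on `ℝ^d` with distribution function `G_ϑ(· | H)`. -/
def IsMaxStableLaw {d : ℕ} (H : Measure (stdSimplex ℝ (Fin d))) (ty : MarginType d)
    (G : Measure (Fin d → ℝ)) : Prop :=
  ∀ x : Fin d → ℝ, G.real (Iic x) = maxStableDF H ty x

/-! ### Domain of attraction and block maxima -/

/-- `F` is in the max-domain of attraction of `G`: for suitable norming sequences `a_m > 0` and
`b_m`, `F^m(a_m x + b_m) → G(x)` for all `x`. -/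
def InMaxDomain {d : ℕ} (F G : Measure (Fin d → ℝ)) : Prop :=
  ∃ a b : ℕ → Fin d → ℝ, (∀ m j, 0 < a m j) ∧
    ∀ x : Fin d → ℝ,
      Tendsto (fun m : ℕ => F.real (Iic (fun j => a m j * x j + b m j)) ^ m) atTop
        (𝓝 (G.real (Iic x)))

/-- The `j`-th marginal distribution function of `F`. -/
def margCDF {d : ℕ} (F : Measure (Fin d → ℝ)) (j : Fin d) (t : ℝ) : ℝ :=
  F.real {z | z j ≤ t}

/-- The left generalised inverse `inf {x | t ≤ φ x}`. -/
def leftInv (φ : ℝ → ℝ) (t : ℝ) : ℝ := sInf {x | t ≤ φ x}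

/-- The upper endpoint `sup {z | φ z < 1}`, possibly infinite. -/
def upperEndpoint (φ : ℝ → ℝ) : EReal := sSup ((fun z : ℝ => (z : EReal)) '' {z | φ z < 1})

/-- The filter of real `z` tending to the upper endpoint from below. -/
def toEndpoint (φ : ℝ → ℝ) : Filter ℝ :=
  comap (fun z : ℝ => (z : EReal)) (𝓝[<] upperEndpoint φ)

/-- `C` is a copula: on the unit cube it is the distribution function of a probability
measure whose margins are uniform on `[0, 1]`. -/
def IsCopula {d : ℕ} (C : (Fin d → ℝ) → ℝ) : Prop :=
  ∃ κ : Measure (Fin d → ℝ), IsProbabilityMeasure κ ∧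
    (∀ j, κ.map (fun u => u j) = volume.restrict (Icc (0 : ℝ) 1)) ∧
    ∀ u : Fin d → ℝ, (∀ j, u j ∈ Icc (0 : ℝ) 1) → C u = κ.real (Iic u)

/-- The smoothness and dependence condition on the copula `C` of the data and on the stable tail
dependence function of the limit, along the block sizes `m n`. -/
structure CopulaCondition {d : ℕ} (H : Measure (stdSimplex ℝ (Fin d))) (m : ℕ → ℕ)
    (C : (Fin d → ℝ) → ℝ) : Prop where
  copula_smooth : ContDiffOn ℝ d C {u | ∀ j, u j ∈ Ioo (0 : ℝ) 1}
  tail_smooth : ContDiffOn ℝ d (stableTail H) {x | ∀ j, 0 < x j}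
  tendsto : ∀ I : Finset (Fin d), ∀ x : Fin d → ℝ, (∀ j, 0 < x j) →
    Tendsto
      (fun n => mixedPartial I
        (fun y => (m n : ℝ) * (C (fun j => 1 - y j / (m n : ℝ)) - 1)) x)
      atTop (𝓝 (-mixedPartial I (stableTail H) x))

/-- The von Mises type conditions on a marginal distribution function `φ`. In the Gumbel case
`1 - φ` vanishes above the upper endpoint, so the integral over `(z, ∞)` is the integral
from `z` to the upper endpoint. -/
def VonMises {d : ℕ} (ty : MarginType d) (j : Fin d) (φ : ℝ → ℝ) : Prop :=
  match ty with
  | .frechet ρ =>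
      Tendsto (fun z => z * deriv φ z / (1 - φ z)) atTop (𝓝 (ρ j)) ∧ φ 0 = 0
  | .weibull ω =>
      upperEndpoint φ ≠ ⊤ ∧
      Tendsto (fun z => ((upperEndpoint φ).toReal - z) * deriv φ z / (1 - φ z))
        (toEndpoint φ) (𝓝 (ω j))
  | .gumbel =>
      Tendsto (fun z => deriv φ z / (1 - φ z) ^ 2 * ∫ t in Ioi z, (1 - φ t))
        (toEndpoint φ) (𝓝 1)

/-- The conditions for `F` to be in the variational max-domain of the max-stable law `G` with
angular measure `H` and margins of type `ty`. -/
structure VariationalCondition {d : ℕ} (F G : Measure (Fin d → ℝ))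
    (H : Measure (stdSimplex ℝ (Fin d))) (ty : MarginType d) (m : ℕ → ℕ) : Prop where
  mem_domain : InMaxDomain F G
  copula : ∃ C : (Fin d → ℝ) → ℝ, IsCopula C ∧
    (∀ z : Fin d → ℝ, F.real (Iic z) = C (fun j => margCDF F j (z j))) ∧
    CopulaCondition H m C
  margin_continuous : ∀ j, Continuous (margCDF F j)
  margin_smooth : ∀ j, ContDiffOn ℝ 1 (margCDF F j) {z | 0 < margCDF F j z ∧ margCDF F j z < 1}
  vonMises : ∀ j, VonMises ty j (margCDF F j)

/-- The location norming constants `b_m`. -/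
def normLoc {d : ℕ} (F : Measure (Fin d → ℝ)) (ty : MarginType d) (m : ℕ) (j : Fin d) : ℝ :=
  match ty with
  | .frechet _ => 0
  | .weibull _ => (upperEndpoint (margCDF F j)).toReal
  | .gumbel => leftInv (margCDF F j) (1 - 1 / (m : ℝ))

/-- The scale norming constants `a_m`. -/
def normScale {d : ℕ} (F : Measure (Fin d → ℝ)) (ty : MarginType d) (m : ℕ) (j : Fin d) : ℝ :=
  match ty with
  | .frechet _ => leftInv (margCDF F j) (1 - 1 / (m : ℝ))
  | .weibull _ =>
      (upperEndpoint (margCDF F j)).toReal - leftInv (margCDF F j) (1 - 1 / (m : ℝ))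
  | .gumbel =>
      (m : ℝ) * ∫ z in Ioi (leftInv (margCDF F j) (1 - 1 / (m : ℝ))), (1 - margCDF F j z)

/-- The normalised componentwise maximum `(max (z_1, …, z_m) - b_m) / a_m` of a block. -/
def normMax {d : ℕ} (F : Measure (Fin d → ℝ)) (ty : MarginType d) (m : ℕ)
    (z : Fin m → Fin d → ℝ) : Fin d → ℝ :=
  fun j => ((⨆ k : Fin m, z k j) - normLoc F ty m j) / normScale F ty m j

/-- The law of one normalised block maximum, that is `F^m(a_m · + b_m)`. -/
def normMaxLaw {d : ℕ} (F : Measure (Fin d → ℝ)) (ty : MarginType d) (m : ℕ) :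
    Measure (Fin d → ℝ) :=
  (Measure.pi fun _ : Fin m => F).map (normMax F ty m)

/-- The joint law of the `n` normalised maxima obtained from `n * m` independent vectors with law
`F`, arranged in `n` blocks of size `m`. -/
def jointMaxLaw {d : ℕ} (F : Measure (Fin d → ℝ)) (ty : MarginType d) (n m : ℕ) :
    Measure (Fin n → Fin d → ℝ) :=
  (Measure.pi fun _ : Fin n => Measure.pi fun _ : Fin m => F).map
    (fun z i => normMax F ty m (z i))

/-- The ratios `f_{m n} / g` of the Lebesgue densities of the normalised maxima and of `G` are
essentially bounded, uniformly in `n ≥ n₀`. The quotient is taken in `[0, ∞]`, so it is infinite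
where only `g` vanishes. -/
def DensityRatioBounded {d : ℕ} (F G : Measure (Fin d → ℝ)) (ty : MarginType d)
    (m : ℕ → ℕ) : Prop :=
  ∃ (n₀ : ℕ) (J₀ : ℝ≥0),
    (⨆ n ≥ n₀, essSup
      (fun x => (normMaxLaw F ty (m n)).rnDeriv volume x / G.rnDeriv volume x) volume) < J₀

/-- `Q` is `υ`-to-`τ` remotely contiguous with respect to `P`: for all sequences of measurable
events, `P_n(E_n) = o(υ_n)` implies `Q_n(E_n) = o(τ_n)`. -/
def RemotelyContiguous {X : ℕ → Type*} [∀ n, MeasurableSpace (X n)]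
    (Q P : ∀ n, Measure (X n)) (υ τ : ℕ → ℝ) : Prop :=
  ∀ E : ∀ n, Set (X n), (∀ n, MeasurableSet (E n)) →
    (fun n => (P n).real (E n)) =o[atTop] υ → (fun n => (Q n).real (E n)) =o[atTop] τ

end MaxStable

end

/-!
Write `P_n` for the law of one normalised block maximum, so that `Q_n` is the `n`-fold product of
`P_n`. The density ratio `r_n = dP_n / dG` is bounded by a constant, and the Cauchy–Schwarz
inequality gives `Q_n(E) ^ 2 ≤ G^n(E) * (∫ r_n ^ 2 dG) ^ n`. If the second moments of `r_n` tend
to `1`, then the second factor grows more slowly than any exponential, and `G^n(E_n) = o(e^{-cn})`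
makes `Q_n(E_n)` decay exponentially, hence faster than any power of `n`. For bounded ratios the
second moments tend to `1` as soon as `P_n` converges to `G` in total variation; both steps are in
`remotelyContiguous_pi`.

Convergence in total variation comes from the convergence of densities. Let `φ_j` be the margins
of the data. In the coordinates `m (1 - φ_j (a_m x_j + b_m))` (`blockTail`) the law `P_n` has the
survival function `C (1 - v / m) ^ m` on `(0, m) ^ d`, while in the coordinates `-log G_j (x_j)`
(`marginTail`) the law `G` has the survival function `exp (-L v)` on `(0, ∞) ^ d`. A measure with a
smooth survival function has the mixed derivative of that function as its density
(`restrict_eq_withDensity_negPartials`), and `density_of_survival` transfers this to the original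
coordinates. The mixed derivatives converge pointwise because those of `m (C (1 - v / m) - 1)`
converge to those of `-L` (`MixedTendsto.pow_sub`). The coordinates and their derivatives converge
by the von Mises conditions (`tendsto_marginTail`). A form of Scheffé's lemma
(`eventually_measure_le_add`) combines the two: it needs no local uniformity of the first
convergence, since the densities are compared in the coordinates `v`, in which the
reparametrisation costs nothing.
-/

noncomputable section


/-! ### Mixed partial derivatives and finite differences -/

namespace MaxStable

variable {ι : Type*} [Fintype ι] [DecidableEq ι]

/-- The negated partial derivative `-∂f/∂x_i`. The sign is chosen for survival functions, whose
mixed derivatives of this kind are densities. -/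
def negPartial (i : ι) (f : (ι → ℝ) → ℝ) (x : ι → ℝ) : ℝ := -fderiv ℝ f x (Pi.single i 1)

/-- Iterated negated partial derivatives along a list of coordinates; the head of the list is the
innermost derivative. -/
def negPartials : List ι → ((ι → ℝ) → ℝ) → (ι → ℝ) → ℝ
  | [], f => f
  | i :: l, f => negPartials l (negPartial i f)

/-- Iterated differences `f(…, s_i, …) - f(…, t_i, …)` along a list of coordinates. For a survival
function this is the mass of a box that is bounded in these coordinates. -/
def boxDiff (s t : ι → ℝ) : List ι → ((ι → ℝ) → ℝ) → (ι → ℝ) → ℝ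
  | [], f, x => f x
  | i :: l, f, x =>
      boxDiff s t l f (Function.update x i (s i)) - boxDiff s t l f (Function.update x i (t i))

lemma ContDiffOn.negPartial {n : ℕ} {U : Set (ι → ℝ)} (hU : IsOpen U) {f : (ι → ℝ) → ℝ}
    (hf : ContDiffOn ℝ (n + 1 : ℕ) f U) (i : ι) : ContDiffOn ℝ n (negPartial i f) U := by
  have h : ContDiffOn ℝ n (fderiv ℝ f) U := hf.fderiv_of_isOpen hU (by norm_cast)
  exact (h.clm_apply contDiffOn_const).neg

lemma ContDiffOn.negPartials {U : Set (ι → ℝ)} (hU : IsOpen U) (l : List ι) {n : ℕ}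
    {f : (ι → ℝ) → ℝ} (hf : ContDiffOn ℝ (n + l.length : ℕ) f U) :
    ContDiffOn ℝ n (negPartials l f) U := by
  induction l generalizing f with
  | nil => exact hf
  | cons i l ih => exact ih (ContDiffOn.negPartial hU hf i)

lemma continuousOn_negPartials {U : Set (ι → ℝ)} (hU : IsOpen U) (l : List ι)
    {f : (ι → ℝ) → ℝ} (hf : ContDiffOn ℝ l.length f U) :
    ContinuousOn (negPartials l f) U := by
  have := ContDiffOn.negPartials hU l (n := 0) (f := f) (by simpa using hf)
  exact this.continuousOn

omit [Fintype ι] in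
lemma negPartial_congr {U : Set (ι → ℝ)} (hU : IsOpen U) {f g : (ι → ℝ) → ℝ}
    (h : EqOn f g U) (i : ι) : EqOn (negPartial i f) (negPartial i g) U := by
  intro x hx
  have : f =ᶠ[𝓝 x] g := h.eventuallyEq_of_mem (hU.mem_nhds hx)
  simp only [negPartial, this.fderiv_eq]

omit [Fintype ι] in
lemma update_mem_Icc {s t x : ι → ℝ} (hx : x ∈ Icc s t) {i : ι} {r : ℝ}
    (hr : r ∈ Icc (s i) (t i)) : Function.update x i r ∈ Icc s t := by
  constructor <;> intro j <;> by_cases h : j = i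
  · subst h; simpa using hr.1
  · simpa [h] using hx.1 j
  · subst h; simpa using hr.2
  · simpa [h] using hx.2 j

omit [Fintype ι] in
lemma continuousOn_boxDiff {s t s' t' : ι → ℝ} (h1 : s ≤ s') (h2 : s' ≤ t') (h3 : t' ≤ t)
    (l : List ι) {f : (ι → ℝ) → ℝ} (hf : ContinuousOn f (Icc s t)) :
    ContinuousOn (boxDiff s' t' l f) (Icc s t) := by
  induction l with
  | nil => exact hf
  | cons i l ih =>
    refine ContinuousOn.sub (ih.comp ?_ ?_) (ih.comp ?_ ?_)
    · exact (continuous_id.update i continuous_const).continuousOn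
    · exact fun x hx => update_mem_Icc hx ⟨h1 i, (h2 i).trans (h3 i)⟩
    · exact (continuous_id.update i continuous_const).continuousOn
    · exact fun x hx => update_mem_Icc hx ⟨(h1 i).trans (h2 i), h3 i⟩

lemma hasDerivAt_boxDiff {U : Set (ι → ℝ)} (hU : IsOpen U) {s t s' t' : ι → ℝ}
    (hst : Icc s t ⊆ U) (h1 : s ≤ s') (h2 : s' ≤ t') (h3 : t' ≤ t) {i : ι} (l : List ι)
    (hi : i ∉ l) {f : (ι → ℝ) → ℝ} (hf : DifferentiableOn ℝ f U) {x : ι → ℝ} (hx : x ∈ Icc s t)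
    {r : ℝ} (hr : r ∈ Icc (s i) (t i)) :
    HasDerivAt (fun r => boxDiff s' t' l f (Function.update x i r))
      (-boxDiff s' t' l (negPartial i f) (Function.update x i r)) r := by
  induction l generalizing x with
  | nil =>
    have hm : Function.update x i r ∈ U := hst (update_mem_Icc hx hr)
    have hd := (hf.differentiableAt (hU.mem_nhds hm)).hasFDerivAt
    have := hd.comp_hasDerivAt r (hasDerivAt_update x i r)
    simpa [boxDiff, negPartial, Function.comp_def] using this
  | cons j l ih =>
    have hij : i ≠ j := fun h => hi (by simp [h])
    have hil : i ∉ l := fun h => hi (by simp [h])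
    have e1 := ih hil (update_mem_Icc (i := j) (r := s' j) hx ⟨h1 j, (h2 j).trans (h3 j)⟩)
    have e2 := ih hil (update_mem_Icc (i := j) (r := t' j) hx ⟨(h1 j).trans (h2 j), h3 j⟩)
    have := e1.sub e2
    simp only [boxDiff, Function.update_comm hij]
    convert! this using 1
    ring

/-- All iterated differences along `l` over subboxes of `Icc s t` are nonnegative. -/
def BoxDiffNonneg (s t : ι → ℝ) (l : List ι) (f : (ι → ℝ) → ℝ) : Prop :=
  ∀ s' t', s ≤ s' → s' ≤ t' → t' ≤ t → ∀ x ∈ Icc s t, 0 ≤ boxDiff s' t' l f x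

omit [Fintype ι] in
lemma boxDiff_congr {s t s' t' : ι → ℝ} (l : List ι) (hs : ∀ i ∈ l, s i = s' i)
    (ht : ∀ i ∈ l, t i = t' i) (f : (ι → ℝ) → ℝ) : boxDiff s t l f = boxDiff s' t' l f := by
  induction l with
  | nil => rfl
  | cons i l ih =>
    have := ih (fun j hj => hs j (by simp [hj])) (fun j hj => ht j (by simp [hj]))
    ext x
    simp [boxDiff, this, hs i, ht i]

lemma BoxDiffNonneg.negPartial {U : Set (ι → ℝ)} (hU : IsOpen U) {s t : ι → ℝ}
    (hst : Icc s t ⊆ U) (hlt : ∀ i, s i < t i) {i : ι} {l : List ι} (hi : i ∉ l)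
    {f : (ι → ℝ) → ℝ} (hf : DifferentiableOn ℝ f U) (h : BoxDiffNonneg s t (i :: l) f) :
    BoxDiffNonneg s t l (negPartial i f) := by
  intro s' t' h1 h2 h3 x hx
  have hxi : x i ∈ Icc (s i) (t i) := ⟨hx.1 i, hx.2 i⟩
  have hd := (hasDerivAt_boxDiff hU hst h1 h2 h3 l hi hf hx hxi).hasDerivWithinAt
    (s := Icc (s i) (t i))
  have hanti : AntitoneOn (fun r => boxDiff s' t' l f (Function.update x i r))
      (Icc (s i) (t i)) := by
    intro r hr r' hr' hrr
    have := h (Function.update s' i r) (Function.update t' i r') ?_ ?_ ?_ x hx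
    · simp only [boxDiff, Function.update_self] at this
      rw [boxDiff_congr (s' := s') (t' := t') l] at this
      · exact sub_nonneg.mp this
      · intro j hj
        rw [Function.update_of_ne (ne_of_mem_of_not_mem hj hi)]
      · intro j hj
        rw [Function.update_of_ne (ne_of_mem_of_not_mem hj hi)]
    all_goals
      intro j
      by_cases hj : j = i
      · subst hj
        simp [hr.1, hr'.2, hrr]
      · simp [hj, h1 j, h2 j, h3 j]
  have hacc : AccPt (x i) (𝓟 (Icc (s i) (t i))) :=
    ((convex_Icc (s i) (t i)).isPreconnected).preperfect_of_nontrivial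
      ⟨s i, left_mem_Icc.mpr (hlt i).le, t i, right_mem_Icc.mpr (hlt i).le, (hlt i).ne⟩ _ hxi
  have := hd.nonpos_of_antitoneOn hacc hanti
  rw [Function.update_eq_self] at this
  linarith

/-- The fundamental theorem of calculus in several coordinates: the marginal integral of a mixed
derivative over a box is the corresponding iterated difference. -/
lemma lmarginal_negPartials {U : Set (ι → ℝ)} (hU : IsOpen U) {s t : ι → ℝ}
    (hst : Icc s t ⊆ U) (hlt : ∀ i, s i < t i) (l : List ι) (hl : l.Nodup)
    {f : (ι → ℝ) → ℝ} (hf : ContDiffOn ℝ l.length f U) (hpos : BoxDiffNonneg s t l f)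
    {F : (ι → ℝ) → ℝ≥0∞} (hF : Measurable F)
    (hFf : ∀ x ∈ Icc s t, F x = ENNReal.ofReal (negPartials l f x)) {x : ι → ℝ}
    (hx : x ∈ Icc s t) :
    lmarginal (fun i => (volume : Measure ℝ).restrict (Ico (s i) (t i))) l.toFinset F x
      = ENNReal.ofReal (boxDiff s t l f x) := by
  have hle : s ≤ t := fun i => (hlt i).le
  induction l generalizing f x with
  | nil => simpa [boxDiff, negPartials] using hFf x hx
  | cons i l ih =>
    obtain ⟨hil, hl⟩ := List.nodup_cons.mp hl
    have hfd : DifferentiableOn ℝ f U := hf.differentiableOn (by simp)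
    have hpos' := hpos.negPartial hU hst hlt hil hfd
    have hf' : ContDiffOn ℝ l.length (negPartial i f) U := ContDiffOn.negPartial hU hf i
    rw [List.toFinset_cons, lmarginal_insert _ hF (by simpa using hil)]
    have hcont : ContinuousOn
        (fun r => boxDiff s t l (negPartial i f) (Function.update x i r)) (Icc (s i) (t i)) := by
      refine ContinuousOn.comp (continuousOn_boxDiff le_rfl hle le_rfl l
        (hf'.continuousOn.mono hst)) ?_ (fun r hr => update_mem_Icc hx hr)
      exact ((continuous_const (y := x)).update i continuous_id).continuousOn
    have hint : IntervalIntegrable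
        (fun r => boxDiff s t l (negPartial i f) (Function.update x i r)) volume (s i) (t i) :=
      ContinuousOn.intervalIntegrable (by rwa [uIcc_of_le (hle i)])
    have hftc : ∫ r in s i..t i, boxDiff s t l (negPartial i f) (Function.update x i r)
        = boxDiff s t (i :: l) f x := by
      have := intervalIntegral.integral_eq_sub_of_hasDerivAt
        (f := fun r => boxDiff s t l f (Function.update x i r))
        (fun r hr => hasDerivAt_boxDiff hU hst le_rfl hle le_rfl l hil hfd hx
          (by rwa [uIcc_of_le (hle i)] at hr)) hint.neg
      rw [intervalIntegral.integral_neg] at this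
      simp only [boxDiff]
      linarith
    calc _ = ∫⁻ r in Ico (s i) (t i),
          ENNReal.ofReal (boxDiff s t l (negPartial i f) (Function.update x i r)) := by
          refine setLIntegral_congr_fun measurableSet_Ico fun r hr => ?_
          exact ih hl hf' hpos' hFf (update_mem_Icc hx ⟨hr.1, hr.2.le⟩)
      _ = ENNReal.ofReal (boxDiff s t (i :: l) f x) := by
          rw [← hftc, intervalIntegral.integral_of_le (hle i), ← integral_Ico_eq_integral_Ioc,
            ofReal_integral_eq_lintegral_ofReal]
          · exact (hcont.integrableOn_Icc).mono_set Ico_subset_Icc_self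
          · refine (ae_restrict_iff' measurableSet_Ico).mpr (ae_of_all _ fun r hr => ?_)
            exact hpos' s t le_rfl hle le_rfl _ (update_mem_Icc hx ⟨hr.1, hr.2.le⟩)

/-! ### Densities of laws with a smooth survival function -/

lemma measureReal_box_eq_boxDiff {U : Set (ι → ℝ)} {s t s' t' : ι → ℝ} (hst : Icc s t ⊆ U)
    (h1 : s ≤ s') (h2 : s' ≤ t') (h3 : t' ≤ t)
    {μ : Measure (ι → ℝ)} [IsFiniteMeasure μ] {f : (ι → ℝ) → ℝ}
    (hμ : ∀ v ∈ U, μ.real (Ici v) = f v) (l : List ι) (hl : l.Nodup) {x : ι → ℝ}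
    (hx : x ∈ Icc s t) :
    μ.real {z | (∀ j ∈ l, s' j ≤ z j ∧ z j < t' j) ∧ ∀ j ∉ l, x j ≤ z j}
      = boxDiff s' t' l f x := by
  induction l generalizing x with
  | nil =>
    rw [boxDiff, ← hμ x (hst hx)]
    congr 1
    ext z
    simp [Pi.le_def]
  | cons i l ih =>
    obtain ⟨hil, hl⟩ := List.nodup_cons.mp hl
    have e1 := ih hl (update_mem_Icc (i := i) (r := s' i) hx ⟨h1 i, (h2 i).trans (h3 i)⟩)
    have e2 := ih hl (update_mem_Icc (i := i) (r := t' i) hx ⟨(h1 i).trans (h2 i), h3 i⟩)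
    rw [boxDiff, ← e1, ← e2, ← measureReal_sdiff]
    · congr 1
      ext z
      simp only [Set.mem_sdiff, Set.mem_ofPred_eq, List.mem_cons, not_or, not_and, not_forall,
        forall_eq_or_imp, and_imp]
      constructor
      · rintro ⟨⟨⟨ha, hb⟩, hc⟩, hd⟩
        refine ⟨⟨hc, fun j hj => ?_⟩, fun _ => ⟨i, hil, ?_⟩⟩
        · by_cases hji : j = i
          · subst hji; simpa using ha
          · simpa [hji] using hd j hji hj
        · simpa using hb
      · rintro ⟨⟨ha, hb⟩, hc⟩
        have hd : ∀ j, j ≠ i → j ∉ l → x j ≤ z j := fun j hj hjl => by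
          simpa [hj] using hb j hjl
        refine ⟨⟨⟨by simpa using hb i hil, ?_⟩, ha⟩, hd⟩
        obtain ⟨j, hj, hlt⟩ := hc ha
        by_cases hji : j = i
        · subst hji; simpa using hlt
        · exact absurd (hd j hji hj) (by simpa [hji] using hlt)
    · rintro z ⟨ha, hb⟩
      refine ⟨ha, fun j hj => le_trans ?_ (hb j hj)⟩
      by_cases hji : j = i
      · subst hji; simpa using h2 j
      · simp [hji]
    · refine MeasurableSet.inter (s₁ := {z : ι → ℝ | ∀ j ∈ l, s' j ≤ z j ∧ z j < t' j})
        (s₂ := {z : ι → ℝ | ∀ j ∉ l, Function.update x i (t' i) j ≤ z j}) ?_ ?_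
      · simp only [Set.ofPred_forall]
        exact MeasurableSet.iInter fun j => MeasurableSet.iInter fun _ =>
          (measurableSet_le measurable_const (measurable_pi_apply j)).inter
            (measurableSet_lt (measurable_pi_apply j) measurable_const)
      · simp only [Set.ofPred_forall]
        exact MeasurableSet.iInter fun j => MeasurableSet.iInter fun _ =>
          measurableSet_le measurable_const (measurable_pi_apply j)

omit [DecidableEq ι] in
/-- Finite measures on `ℝ^ι` with equal masses of upper orthants and equal total masses agree. -/
lemma Measure.ext_of_Ici_pi {μ ν : Measure (ι → ℝ)} [IsFiniteMeasure μ]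
    (huniv : μ univ = ν univ) (h : ∀ v, μ (Ici v) = ν (Ici v)) : μ = ν := by
  have hspan : IsCountablySpanning (range (Ici : ℝ → Set ℝ)) := by
    refine ⟨fun n => Ici (-(n : ℝ)), fun n => ⟨_, rfl⟩, ?_⟩
    refine eq_univ_of_forall fun x => mem_iUnion.mpr ?_
    obtain ⟨n, hn⟩ := exists_nat_ge (-x)
    exact ⟨n, by simp only [mem_Ici]; linarith⟩
  have hgen := generateFrom_eq_pi (fun _ : ι => (borel_eq_generateFrom_Ici ℝ).symm.trans
    (BorelSpace.measurable_eq (α := ℝ)).symm) (fun _ => hspan)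
  refine ext_of_generate_finite _ hgen.symm
    (IsPiSystem.pi fun _ => isPiSystem_Ici) ?_ huniv
  · rintro _ ⟨a, ha, rfl⟩
    choose v hv using fun i => ha i (mem_univ i)
    have : pi univ a = Ici v := by
      rw [← pi_univ_Ici]
      exact congrArg _ (funext fun i => (hv i).symm)
    rw [this, h]

/-- A finite measure whose survival function is smooth on an open set `U` has on `U` the mixed
derivative of its survival function as density. -/
theorem restrict_eq_withDensity_negPartials {U : Set (ι → ℝ)} (hU : IsOpen U)
    {μ : Measure (ι → ℝ)} [IsFiniteMeasure μ] {f : (ι → ℝ) → ℝ}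
    (hμ : ∀ v ∈ U, μ.real (Ici v) = f v) (l : List ι) (hl : l.Nodup) (hmem : ∀ i, i ∈ l)
    (hf : ContDiffOn ℝ l.length f U) {F : (ι → ℝ) → ℝ≥0∞} (hF : Measurable F)
    (hFf : ∀ x ∈ U, F x = ENNReal.ofReal (negPartials l f x)) :
    μ.restrict U = (volume.withDensity F).restrict U := by
  -- On a half-open box inside `U` both measures of a subbox are the same iterated difference.
  have hbox : ∀ s t : ι → ℝ, Icc s t ⊆ U → (∀ i, s i < t i) →
      μ (pi univ fun i => Ico (s i) (t i)) =
        volume.withDensity F (pi univ fun i => Ico (s i) (t i)) := by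
    intro s t hst hlt
    have hle : s ≤ t := fun i => (hlt i).le
    have hpos : BoxDiffNonneg s t l f := fun s' t' h1 h2 h3 x hx => by
      rw [← measureReal_box_eq_boxDiff hst h1 h2 h3 hμ l hl hx]
      exact measureReal_nonneg
    have hx : s ∈ Icc s t := ⟨le_rfl, hle⟩
    have h1 := lmarginal_negPartials hU hst hlt l hl hf hpos hF (fun x hx => hFf x (hst hx)) hx
    have h2 := measureReal_box_eq_boxDiff hst le_rfl hle le_rfl hμ l hl hx
    have hl' : l.toFinset = Finset.univ := by ext; simp [hmem]
    have hset : {z : ι → ℝ | (∀ j ∈ l, s j ≤ z j ∧ z j < t j) ∧ ∀ j ∉ l, s j ≤ z j}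
        = pi univ fun i => Ico (s i) (t i) := by
      ext z; simp [hmem]
    rw [hl', lmarginal_univ, ← Measure.restrict_pi_pi, ← volume_pi] at h1
    rw [hset] at h2
    rw [withDensity_apply _ (MeasurableSet.univ_pi fun _ => measurableSet_Ico)]
    refine Eq.trans ?_ h1.symm
    rw [← h2,
      ofReal_measureReal]
  have hbox' : ∀ s t : ι → ℝ, Icc s t ⊆ U → (∀ i, s i < t i) →
      μ.restrict (pi univ fun i => Ico (s i) (t i)) =
        (volume.withDensity F).restrict (pi univ fun i => Ico (s i) (t i)) := by
    intro s t hst hlt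
    refine Measure.ext_of_Ici_pi (by simpa using hbox s t hst hlt) fun v => ?_
    rw [Measure.restrict_apply measurableSet_Ici, Measure.restrict_apply measurableSet_Ici]
    have : Ici v ∩ (pi univ fun i => Ico (s i) (t i)) = pi univ fun i => Ico ((s ⊔ v) i) (t i) := by
      ext z
      simp only [mem_inter_iff, mem_Ici, Pi.le_def, mem_univ_pi, mem_Ico, Pi.sup_apply, sup_le_iff]
      exact ⟨fun h i => ⟨⟨(h.2 i).1, h.1 i⟩, (h.2 i).2⟩,
        fun h => ⟨fun i => (h i).1.2, fun i => ⟨(h i).1.1, (h i).2⟩⟩⟩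
    rw [this]
    by_cases hv : ∀ i, (s ⊔ v) i < t i
    · exact hbox _ _ ((Icc_subset_Icc_left le_sup_left).trans hst) hv
    · push Not at hv
      obtain ⟨i, hi⟩ := hv
      have hempty : (pi univ fun i => Ico ((s ⊔ v) i) (t i)) = ∅ :=
        univ_pi_eq_empty (Ico_eq_empty_of_le hi)
      rw [hempty, measure_empty, measure_empty]
  -- Countably many boxes with rational corners cover `U`.
  let T := {p : (ι → ℚ) × (ι → ℚ) // Icc (fun i => (p.1 i : ℝ)) (fun i => (p.2 i : ℝ)) ⊆ U ∧
    ∀ i, (p.1 i : ℝ) < p.2 i}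
  have hcover : U = ⋃ p : T, pi univ fun i => Ico (p.1.1 i : ℝ) (p.1.2 i) := by
    refine Subset.antisymm (fun x hx => ?_) (iUnion_subset fun p z hz => p.2.1
      ⟨fun i => (hz i (mem_univ i)).1, fun i => (hz i (mem_univ i)).2.le⟩)
    obtain ⟨ε, hε, hball⟩ := Metric.isOpen_iff.mp hU x hx
    choose a ha using fun i => exists_rat_btwn (show x i - ε / 2 < x i by linarith)
    choose b hb using fun i => exists_rat_btwn (show x i < x i + ε / 2 by linarith)
    refine mem_iUnion.mpr ⟨⟨(a, b), fun z hz => hball ?_, fun i => (ha i).2.trans (hb i).1⟩,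
      fun i _ => ⟨(ha i).2.le, (hb i).1⟩⟩
    refine (dist_pi_le_iff (half_pos hε).le).mpr (fun i => ?_) |>.trans_lt (half_lt_self hε)
    rw [Real.dist_eq, abs_le]
    have h1 := hz.1 i
    have h2 := hz.2 i
    simp only at h1 h2
    constructor <;> linarith [(ha i).1, (hb i).2]
  rw [hcover]
  exact Measure.restrict_iUnion_congr.mpr fun p => hbox' _ _ p.2.1 p.2.2

end MaxStable

/-! ### Convergence of all mixed partial derivatives -/

namespace MaxStable

variable {ι : Type*} [Fintype ι] [DecidableEq ι]

/-- Pointwise convergence on `V` of the functions `f n` to `g`, together with all iterated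
negated partial derivatives along sublists of the given list. -/
def MixedTendsto (V : Set (ι → ℝ)) :
    List ι → (ℕ → (ι → ℝ) → ℝ) → ((ι → ℝ) → ℝ) → Prop
  | [], f, g => ∀ x ∈ V, Tendsto (fun n => f n x) atTop (𝓝 (g x))
  | i :: l, f, g => MixedTendsto V l f g ∧
      MixedTendsto V l (fun n => negPartial i (f n)) (negPartial i g)

omit [Fintype ι] in
lemma mixedTendsto_of_sublists {V : Set (ι → ℝ)} (l : List ι) {f : ℕ → (ι → ℝ) → ℝ}
    {g : (ι → ℝ) → ℝ}
    (h : ∀ l', l'.Sublist l → ∀ x ∈ V,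
      Tendsto (fun n => negPartials l' (f n) x) atTop (𝓝 (negPartials l' g x))) :
    MixedTendsto V l f g := by
  induction l generalizing f g with
  | nil => exact h [] (List.Sublist.refl _)
  | cons i l ih =>
    exact ⟨ih fun l' hl' => h l' (hl'.cons i), ih fun l' hl' => h (i :: l') (hl'.cons_cons i)⟩

omit [Fintype ι] in
lemma MixedTendsto.tendsto_negPartials {V : Set (ι → ℝ)} (l : List ι) {f : ℕ → (ι → ℝ) → ℝ}
    {g : (ι → ℝ) → ℝ} (h : MixedTendsto V l f g) {x : ι → ℝ} (hx : x ∈ V) :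
    Tendsto (fun n => negPartials l (f n) x) atTop (𝓝 (negPartials l g x)) := by
  induction l generalizing f g with
  | nil => exact h x hx
  | cons i l ih => exact ih h.2

section

variable {U : ℕ → Set (ι → ℝ)} {V : Set (ι → ℝ)}

omit [Fintype ι] in
lemma MixedTendsto.congr (hU : ∀ n, IsOpen (U n)) (hV : IsOpen V)
    (hUV : ∀ x ∈ V, ∀ᶠ n in atTop, x ∈ U n) {l : List ι} {f f' : ℕ → (ι → ℝ) → ℝ}
    {g g' : (ι → ℝ) → ℝ} (h : MixedTendsto V l f g) (hf : ∀ n, EqOn (f n) (f' n) (U n))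
    (hg : EqOn g g' V) : MixedTendsto V l f' g' := by
  induction l generalizing f f' g g' with
  | nil =>
    intro x hx
    rw [← hg hx]
    refine (h x hx).congr' ?_
    filter_upwards [hUV x hx] with n hn using hf n hn
  | cons i l ih =>
    exact ⟨ih h.1 hf hg, ih h.2 (fun n => negPartial_congr (hU n) (hf n) i)
      (negPartial_congr hV hg i)⟩

lemma negPartial_add {W : Set (ι → ℝ)} (hW : IsOpen W) {f g : (ι → ℝ) → ℝ}
    (hf : DifferentiableOn ℝ f W) (hg : DifferentiableOn ℝ g W) (i : ι) :
    EqOn (negPartial i (fun x => f x + g x)) (fun x => negPartial i f x + negPartial i g x) W := by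
  intro x hx
  have h1 := hf.differentiableAt (hW.mem_nhds hx)
  have h2 := hg.differentiableAt (hW.mem_nhds hx)
  simp only [negPartial, fderiv_fun_add h1 h2, add_apply]
  ring

lemma negPartial_mul {W : Set (ι → ℝ)} (hW : IsOpen W) {f g : (ι → ℝ) → ℝ}
    (hf : DifferentiableOn ℝ f W) (hg : DifferentiableOn ℝ g W) (i : ι) :
    EqOn (negPartial i (fun x => f x * g x))
      (fun x => negPartial i f x * g x + f x * negPartial i g x) W := by
  intro x hx
  have h1 := hf.differentiableAt (hW.mem_nhds hx)
  have h2 := hg.differentiableAt (hW.mem_nhds hx)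
  simp only [negPartial, fderiv_fun_mul h1 h2, add_apply,
    smul_apply, smul_eq_mul]
  ring

lemma negPartial_const_mul {W : Set (ι → ℝ)} (hW : IsOpen W) {f : (ι → ℝ) → ℝ}
    (hf : DifferentiableOn ℝ f W) (c : ℝ) (i : ι) :
    EqOn (negPartial i (fun x => c * f x)) (fun x => c * negPartial i f x) W := by
  intro x hx
  have h1 := hf.differentiableAt (hW.mem_nhds hx)
  simp only [negPartial, fderiv_const_mul h1, smul_apply, smul_eq_mul]
  ring

lemma MixedTendsto.add (hU : ∀ n, IsOpen (U n)) (hV : IsOpen V)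
    (hUV : ∀ x ∈ V, ∀ᶠ n in atTop, x ∈ U n) {l : List ι} {f f' : ℕ → (ι → ℝ) → ℝ}
    {g g' : (ι → ℝ) → ℝ} (h : MixedTendsto V l f g) (h' : MixedTendsto V l f' g')
    (hf : ∀ n, ContDiffOn ℝ l.length (f n) (U n)) (hf' : ∀ n, ContDiffOn ℝ l.length (f' n) (U n))
    (hg : ContDiffOn ℝ l.length g V) (hg' : ContDiffOn ℝ l.length g' V) :
    MixedTendsto V l (fun n x => f n x + f' n x) (fun x => g x + g' x) := by
  induction l generalizing f f' g g' with
  | nil => exact fun x hx => (h x hx).add (h' x hx)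
  | cons i l ih =>
    refine ⟨ih h.1 h'.1 ?_ ?_ ?_ ?_, (ih h.2 h'.2 ?_ ?_ ?_ ?_).congr hU hV hUV ?_ ?_⟩
    · exact fun n => (hf n).of_le (by simp)
    · exact fun n => (hf' n).of_le (by simp)
    · exact hg.of_le (by simp)
    · exact hg'.of_le (by simp)
    · exact fun n => ContDiffOn.negPartial (hU n) (hf n) i
    · exact fun n => ContDiffOn.negPartial (hU n) (hf' n) i
    · exact ContDiffOn.negPartial hV hg i
    · exact ContDiffOn.negPartial hV hg' i
    · exact fun n => (negPartial_add (hU n) ((hf n).differentiableOn (by simp))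
        ((hf' n).differentiableOn (by simp)) i).symm
    · exact (negPartial_add hV (hg.differentiableOn (by simp))
        (hg'.differentiableOn (by simp)) i).symm

lemma MixedTendsto.mul (hU : ∀ n, IsOpen (U n)) (hV : IsOpen V)
    (hUV : ∀ x ∈ V, ∀ᶠ n in atTop, x ∈ U n) {l : List ι} {f f' : ℕ → (ι → ℝ) → ℝ}
    {g g' : (ι → ℝ) → ℝ} (h : MixedTendsto V l f g) (h' : MixedTendsto V l f' g')
    (hf : ∀ n, ContDiffOn ℝ l.length (f n) (U n)) (hf' : ∀ n, ContDiffOn ℝ l.length (f' n) (U n))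
    (hg : ContDiffOn ℝ l.length g V) (hg' : ContDiffOn ℝ l.length g' V) :
    MixedTendsto V l (fun n x => f n x * f' n x) (fun x => g x * g' x) := by
  induction l generalizing f f' g g' with
  | nil => exact fun x hx => (h x hx).mul (h' x hx)
  | cons i l ih =>
    have e1 : ∀ n, ContDiffOn ℝ l.length (f n) (U n) := fun n => (hf n).of_le (by simp)
    have e2 : ∀ n, ContDiffOn ℝ l.length (f' n) (U n) := fun n => (hf' n).of_le (by simp)
    have e3 : ContDiffOn ℝ l.length g V := hg.of_le (by simp)
    have e4 : ContDiffOn ℝ l.length g' V := hg'.of_le (by simp)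
    have d1 := fun n => ContDiffOn.negPartial (hU n) (hf n) i
    have d2 := fun n => ContDiffOn.negPartial (hU n) (hf' n) i
    have d3 := ContDiffOn.negPartial hV hg i
    have d4 := ContDiffOn.negPartial hV hg' i
    refine ⟨ih h.1 h'.1 e1 e2 e3 e4, MixedTendsto.congr hU hV hUV (MixedTendsto.add hU hV hUV
      (ih h.2 h'.1 d1 e2 d3 e4) (ih h.1 h'.2 e1 d2 e3 d4) ?_ ?_ ?_ ?_) ?_ ?_⟩
    · exact fun n => (d1 n).mul (e2 n)
    · exact fun n => (e1 n).mul (d2 n)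
    · exact d3.mul e4
    · exact e3.mul d4
    · exact fun n => (negPartial_mul (hU n) ((hf n).differentiableOn (by simp))
        ((hf' n).differentiableOn (by simp)) i).symm
    · exact (negPartial_mul hV (hg.differentiableOn (by simp))
        (hg'.differentiableOn (by simp)) i).symm

lemma MixedTendsto.const_mul (hU : ∀ n, IsOpen (U n)) (hV : IsOpen V)
    (hUV : ∀ x ∈ V, ∀ᶠ n in atTop, x ∈ U n) {l : List ι} {f : ℕ → (ι → ℝ) → ℝ}
    {g : (ι → ℝ) → ℝ} (h : MixedTendsto V l f g) {c : ℕ → ℝ} {c₀ : ℝ}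
    (hc : Tendsto c atTop (𝓝 c₀)) (hf : ∀ n, ContDiffOn ℝ l.length (f n) (U n))
    (hg : ContDiffOn ℝ l.length g V) :
    MixedTendsto V l (fun n x => c n * f n x) (fun x => c₀ * g x) := by
  induction l generalizing f g with
  | nil => exact fun x hx => hc.mul (h x hx)
  | cons i l ih =>
    refine ⟨ih h.1 (fun n => (hf n).of_le (by simp)) (hg.of_le (by simp)),
      (ih h.2 (fun n => ContDiffOn.negPartial (hU n) (hf n) i)
        (ContDiffOn.negPartial hV hg i)).congr hU hV hUV ?_ ?_⟩
    · exact fun n => (negPartial_const_mul (hU n) ((hf n).differentiableOn (by simp)) _ i).symm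
    · exact (negPartial_const_mul hV (hg.differentiableOn (by simp)) _ i).symm

/-- If `p_n (c_n - 1) → t` with `p_n → ∞`, then `c_n ^ (p_n - k) → exp t`. -/
lemma tendsto_pow_sub_exp {p : ℕ → ℕ} (hp : Tendsto p atTop atTop) {c : ℕ → ℝ} {t : ℝ}
    (h : Tendsto (fun n => (p n : ℝ) * (c n - 1)) atTop (𝓝 t)) (k : ℕ) :
    Tendsto (fun n => c n ^ (p n - k)) atTop (𝓝 (Real.exp t)) := by
  have hp' : Tendsto (fun n => (p n : ℝ)) atTop atTop := tendsto_natCast_atTop_atTop.comp hp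
  have hpos : ∀ᶠ n in atTop, 0 < (p n : ℝ) := hp'.eventually_gt_atTop 0
  have hc : Tendsto c atTop (𝓝 1) := by
    have h0 : Tendsto (fun n => (p n : ℝ)⁻¹ * ((p n : ℝ) * (c n - 1)) + 1) atTop (𝓝 1) := by
      simpa using ((tendsto_inv_atTop_zero.comp hp').mul h).add_const 1
    refine h0.congr' ?_
    filter_upwards [hpos] with n hn
    field_simp
    ring
  have hcpos : ∀ᶠ n in atTop, 0 < c n := hc.eventually (lt_mem_nhds one_pos)
  have hlog : Tendsto (fun n => (p n : ℝ) * Real.log (c n)) atTop (𝓝 t) := by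
    have hlow : Tendsto (fun n => (p n : ℝ) * (c n - 1) / c n) atTop (𝓝 t) := by
      simpa [Pi.div_def] using h.div hc one_ne_zero
    refine tendsto_of_tendsto_of_tendsto_of_le_of_le' hlow h ?_ ?_
    · filter_upwards [hcpos, hpos] with n hn hn'
      have := Real.one_sub_inv_le_log_of_pos hn
      calc (p n : ℝ) * (c n - 1) / c n = p n * (1 - (c n)⁻¹) := by field_simp
        _ ≤ _ := by gcongr
    · filter_upwards [hcpos, hpos] with n hn hn'
      have := Real.log_le_sub_one_of_pos hn
      gcongr
  have hratio : Tendsto (fun n => ((p n - k : ℕ) : ℝ) / p n) atTop (𝓝 1) := by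
    have h0 : Tendsto (fun n => 1 - (k : ℝ) * (p n : ℝ)⁻¹) atTop (𝓝 1) := by
      simpa using ((tendsto_inv_atTop_zero.comp hp').const_mul (k : ℝ)).const_sub 1
    refine h0.congr' ?_
    filter_upwards [hpos, hp.eventually_ge_atTop k] with n hn hk
    rw [Nat.cast_sub hk]
    field_simp
  have := (Real.continuous_exp.tendsto _).comp (hratio.mul hlog)
  rw [one_mul] at this
  refine this.congr' ?_
  filter_upwards [hcpos, hpos] with n hn hn'
  rw [Function.comp_apply, ← mul_assoc, div_mul_cancel₀ _ hn'.ne', mul_comm, Real.exp_mul,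
    Real.exp_log hn, Real.rpow_natCast]

/-- Mixed derivatives of the powers `c_n ^ (p_n - k)` converge to those of `exp g` when the mixed
derivatives of `p_n (c_n - 1)` converge to those of `g`. The shift `k` makes the induction work:
each derivative lowers the exponent by one. -/
lemma MixedTendsto.pow_sub (hU : ∀ n, IsOpen (U n)) (hV : IsOpen V)
    (hUV : ∀ x ∈ V, ∀ᶠ n in atTop, x ∈ U n) {p : ℕ → ℕ} (hp : Tendsto p atTop atTop)
    (l : List ι) {c : ℕ → (ι → ℝ) → ℝ} {g : (ι → ℝ) → ℝ}
    (h : MixedTendsto V l (fun n x => (p n : ℝ) * (c n x - 1)) g)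
    (hc : ∀ n, ContDiffOn ℝ l.length (c n) (U n)) (hg : ContDiffOn ℝ l.length g V) (k : ℕ) :
    MixedTendsto V l (fun n x => c n x ^ (p n - k)) (fun x => Real.exp (g x)) := by
  induction l generalizing k with
  | nil => exact fun x hx => tendsto_pow_sub_exp hp (h x hx) k
  | cons i l ih =>
    have hc' : ∀ n, ContDiffOn ℝ l.length (c n) (U n) := fun n => (hc n).of_le (by simp)
    have hg' : ContDiffOn ℝ l.length g V := hg.of_le (by simp)
    have hratio : Tendsto (fun n => ((p n - k : ℕ) : ℝ) / p n) atTop (𝓝 1) := by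
      have hp' : Tendsto (fun n => (p n : ℝ)) atTop atTop := tendsto_natCast_atTop_atTop.comp hp
      have h0 : Tendsto (fun n => 1 - (k : ℝ) * (p n : ℝ)⁻¹) atTop (𝓝 1) := by
        simpa using ((tendsto_inv_atTop_zero.comp hp').const_mul (k : ℝ)).const_sub 1
      refine h0.congr' ?_
      filter_upwards [hp'.eventually_gt_atTop 0, hp.eventually_ge_atTop k] with n hn hk
      rw [Nat.cast_sub hk]
      field_simp
    have hd : ∀ n, ContDiffOn ℝ l.length
        (negPartial i (fun x => (p n : ℝ) * (c n x - 1))) (U n) := fun n =>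
      ContDiffOn.negPartial (hU n) (contDiffOn_const.mul ((hc n).sub contDiffOn_const)) i
    have hprod := (ih h.1 hc' hg' (k + 1)).mul hU hV hUV h.2
      (fun n => (hc' n).pow _) hd hg'.exp (ContDiffOn.negPartial hV hg i)
    refine ⟨ih h.1 hc' hg' k, (hprod.const_mul hU hV hUV hratio
      (fun n => ((hc' n).pow _).mul (hd n))
      (hg'.exp.mul (ContDiffOn.negPartial hV hg i))).congr hU hV hUV (fun n x hx => ?_)
      fun x hx => ?_⟩
    · have hdx : DifferentiableAt ℝ (c n) x :=
        ((hc n).differentiableOn (by simp)).differentiableAt ((hU n).mem_nhds hx)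
      rcases Nat.eq_zero_or_pos (p n) with h0 | h0
      · simp [h0, negPartial]
      · have h0' : (p n : ℝ) ≠ 0 := by positivity
        simp only [negPartial]
        rw [fderiv_const_mul (hdx.sub_const 1), fderiv_sub_const, fderiv_fun_pow _ hdx]
        simp only [smul_apply, smul_eq_mul, nsmul_eq_mul, Nat.sub_sub]
        field_simp
    · have hdx : DifferentiableAt ℝ g x :=
        (hg.differentiableOn (by simp)).differentiableAt (hV.mem_nhds hx)
      simp only [negPartial]
      rw [fderiv_exp hdx]
      simp

end

/-! ### Comparison with iterated Fréchet derivatives -/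

lemma iteratedFDeriv_single_eq_negPartials {U : Set (ι → ℝ)} (hU : IsOpen U) {n : ℕ}
    {f : (ι → ℝ) → ℝ} (hf : ContDiffOn ℝ n f U) (w : Fin n → ι) {x : ι → ℝ} (hx : x ∈ U) :
    iteratedFDeriv ℝ n f x (fun k => Pi.single (w k) 1)
      = (-1) ^ n * negPartials (List.ofFn fun k => w k.rev) f x := by
  induction n generalizing f with
  | zero => simp [negPartials]
  | succ n ih =>
    have hf1 : ContDiffOn ℝ n (fderiv ℝ f) U := hf.fderiv_of_isOpen hU (by norm_cast)
    have h1 := ih (ContDiffOn.negPartial hU hf (w (Fin.last n))) (fun k => w k.castSucc)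
    rw [iteratedFDeriv_succ_apply_right, List.ofFn_succ]
    simp only [Fin.rev_zero, Fin.rev_succ, negPartials, pow_succ]
    rw [mul_assoc, neg_one_mul, mul_neg, ← h1]
    have : negPartial (w (Fin.last n)) f =
        -fun y => fderiv ℝ f y (Pi.single (w (Fin.last n)) 1) := rfl
    have hcomm := iteratedFDerivWithin_clm_apply_const_apply (i := n)
      (u := Pi.single (w (Fin.last n)) 1)
      (m := fun k => Pi.single (w k.castSucc) 1) hU.uniqueDiffOn hf1 le_rfl hx
    rw [iteratedFDerivWithin_of_isOpen n hU hx, iteratedFDerivWithin_of_isOpen n hU hx] at hcomm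
    rw [this, iteratedFDeriv_neg_apply, neg_apply, neg_neg, hcomm]
    rfl

/-- Up to sign, `mixedPartial` is an iterated negated partial derivative along the decreasing
list of coordinates. -/
lemma mixedPartial_eq_negPartials {d : ℕ} {U : Set (Fin d → ℝ)} (hU : IsOpen U)
    {l : List (Fin d)} (hl : l.Pairwise (· > ·)) {f : (Fin d → ℝ) → ℝ}
    (hf : ContDiffOn ℝ l.length f U) {x : Fin d → ℝ} (hx : x ∈ U) :
    mixedPartial l.toFinset f x = (-1) ^ l.length * negPartials l f x := by
  have hcast : ∀ (I : Finset (Fin d)) (n : ℕ) (h : I.card = n), mixedPartial I f x =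
      iteratedFDeriv ℝ n f x (fun k => Pi.single (I.orderEmbOfFin h k) 1) := by
    rintro I n rfl; rfl
  have hcard : l.toFinset.card = l.length :=
    List.toFinset_card_of_nodup (hl.imp fun h => h.ne')
  have hw : (fun k : Fin l.length => l.get k.rev) = l.toFinset.orderEmbOfFin hcard := by
    refine Finset.orderEmbOfFin_unique hcard (fun k => by simp) fun a b hab => ?_
    exact List.pairwise_iff_get.mp hl _ _ (Fin.rev_lt_rev.mpr hab)
  rw [hcast _ _ hcard, ← hw, iteratedFDeriv_single_eq_negPartials hU hf _ hx]
  simp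

end MaxStable

/-! ### Product measures with densities -/

namespace MaxStable

lemma lintegral_pi_prod {ι : Type*} [Fintype ι] {X : ι → Type*} [∀ i, MeasurableSpace (X i)]
    (μ : ∀ i, Measure (X i)) [∀ i, SigmaFinite (μ i)] {f : ∀ i, X i → ℝ≥0∞}
    (hf : ∀ i, Measurable (f i)) :
    ∫⁻ x, ∏ i, f i (x i) ∂Measure.pi μ = ∏ i, ∫⁻ t, f i t ∂μ i := by
  classical
  have hF : Measurable fun x : ∀ i, X i => ∏ i, f i (x i) :=
    Finset.measurable_prod _ fun i _ => (hf i).comp (measurable_pi_apply i)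
  have key : ∀ (s : Finset ι) (x : ∀ i, X i),
      lmarginal μ s (fun x => ∏ i, f i (x i)) x
        = (∏ i ∈ s, ∫⁻ t, f i t ∂μ i) * ∏ i ∈ sᶜ, f i (x i) := by
    intro s
    induction s using Finset.induction_on with
    | empty => simp
    | insert j s hj ih =>
      intro x
      rw [lmarginal_insert _ hF hj, Finset.prod_insert hj]
      simp_rw [ih]
      have hjc : j ∈ sᶜ := by simpa using hj
      have hc : (insert j s)ᶜ = sᶜ.erase j := by ext; simp
      have : ∀ t, ∏ i ∈ sᶜ, f i (Function.update x j t i)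
          = f j t * ∏ i ∈ (insert j s)ᶜ, f i (x i) := by
        intro t
        rw [← Finset.mul_prod_erase _ _ hjc, Function.update_self, hc]
        congr 1
        refine Finset.prod_congr rfl fun i hi => ?_
        rw [Function.update_of_ne (Finset.ne_of_mem_erase hi)]
      simp_rw [this]
      rw [lintegral_const_mul _ ((hf j).mul_const _), lintegral_mul_const _ (hf j)]
      ring
  by_cases hne : Nonempty (∀ i, X i)
  · obtain ⟨x⟩ := hne
    rw [lintegral_eq_lmarginal_univ x, key]
    simp
  · rw [not_nonempty_iff] at hne
    obtain ⟨i, hi⟩ := isEmpty_pi.mp hne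
    rw [lintegral_of_isEmpty, eq_comm, Finset.prod_eq_zero (Finset.mem_univ i)]
    simp

lemma pi_withDensity {ι : Type*} [Fintype ι] {X : ι → Type*} [∀ i, MeasurableSpace (X i)]
    (μ : ∀ i, Measure (X i)) [∀ i, SigmaFinite (μ i)] {f : ∀ i, X i → ℝ≥0∞}
    (hf : ∀ i, Measurable (f i)) [∀ i, SigmaFinite ((μ i).withDensity (f i))] :
    Measure.pi (fun i => (μ i).withDensity (f i))
      = (Measure.pi μ).withDensity fun x => ∏ i, f i (x i) := by
  refine Measure.pi_eq fun s hs => ?_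
  rw [withDensity_apply _ (MeasurableSet.univ_pi hs), Measure.restrict_pi_pi,
    lintegral_pi_prod _ hf]
  exact Finset.prod_congr rfl fun i _ => (withDensity_apply _ (hs i)).symm

/-! ### Change of variables along antitone coordinate maps -/

lemma map_withDensity_neg_deriv {S : Set ℝ} (hS : MeasurableSet S) {y y' : ℝ → ℝ}
    (hy : Measurable y) (hderiv : ∀ x ∈ S, HasDerivAt y (y' x) x) (hanti : AntitoneOn y S) :
    ((volume.withDensity (S.indicator fun x => ENNReal.ofReal (-y' x))).map y
      : Measure ℝ) = volume.restrict (y '' S) := by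
  ext A hA
  have h := lintegral_image_eq_lintegral_deriv_mul_of_antitoneOn hS
    (fun x hx => (hderiv x hx).hasDerivWithinAt) hanti (A.indicator 1)
  rw [Measure.map_apply hy hA, withDensity_apply _ (hy hA), Measure.restrict_apply hA,
    setLIntegral_indicator hS]
  rw [lintegral_indicator_one hA, Measure.restrict_apply hA] at h
  rw [h, inter_comm, ← setLIntegral_indicator (hy hA)]
  refine lintegral_congr fun x => ?_
  by_cases hx : y x ∈ A <;> simp [hx]

variable {ι : Type*} [Fintype ι]

lemma Ici_ae_eq_preimage_image {S : ι → Set ℝ} {y : ι → ℝ → ℝ}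
    (hanti : ∀ i, AntitoneOn (y i) (S i)) {ν : Measure (ι → ℝ)}
    (hνS : ∀ᵐ x ∂ν, ∀ i, x i ∈ S i) (hν : ∀ i c, ν {x | y i (x i) = c} = 0) (v : ι → ℝ) :
    Ici v =ᵐ[ν] (fun x i => y i (x i)) ⁻¹' pi univ fun i => y i '' (Ici (v i) ∩ S i) := by
  -- For each coordinate, all points below `v i` that are mapped into the image of
  -- `Ici (v i) ∩ S i` have the same image.
  have hc : ∀ i, ∃ c, ∀ x ∈ S i, x < v i → y i x ∈ y i '' (Ici (v i) ∩ S i) → y i x = c := by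
    intro i
    by_cases h : ∃ x ∈ S i, x < v i ∧ y i x ∈ y i '' (Ici (v i) ∩ S i)
    · obtain ⟨x, hxS, hxv, w, ⟨hwv, hwS⟩, hw⟩ := h
      refine ⟨y i x, fun x' hx'S hx'v ⟨w', ⟨hw'v, hw'S⟩, hw'⟩ => le_antisymm ?_ ?_⟩
      · rw [← hw']
        exact hanti i hxS hw'S (hxv.le.trans hw'v)
      · rw [← hw]
        exact hanti i hx'S hwS (hx'v.le.trans hwv)
    · push Not at h
      exact ⟨0, fun x hx hxv hxm => absurd hxm (h x hx hxv)⟩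
  choose c hc using hc
  have hne : ∀ᵐ x ∂ν, ∀ i, y i (x i) ≠ c i := ae_all_iff.mpr fun i => by
    simpa [ae_iff] using hν i (c i)
  filter_upwards [hνS, hne] with x hxS hxc
  refine propext ⟨fun hx i _ => ⟨x i, ⟨hx i, hxS i⟩, rfl⟩, fun hx i => ?_⟩
  by_contra hlt
  exact hxc i (hc i (x i) (hxS i) (not_le.mp hlt) (hx i (mem_univ i)))

/-- A law on `ℝ^ι` is determined by its image under coordinatewise antitone maps `y i`, even where
these maps are not injective, as soon as this image has a density: level sets of `y i` are null. -/
theorem eq_withDensity_comp {S V : ι → Set ℝ} (hS : ∀ i, MeasurableSet (S i)) {y : ι → ℝ → ℝ}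
    (hy : ∀ i, Measurable (y i)) (hanti : ∀ i, AntitoneOn (y i) (S i))
    {ρ : ι → Measure ℝ} [∀ i, SigmaFinite (ρ i)] (hρS : ∀ i, ρ i (S i)ᶜ = 0)
    (hρ : ∀ i, (ρ i).map (y i) = volume.restrict (V i)) {P : Measure (ι → ℝ)} [IsFiniteMeasure P]
    (hPS : ∀ᵐ x ∂P, ∀ i, x i ∈ S i) {K : (ι → ℝ) → ℝ≥0∞} (hK : Measurable K)
    (hP : P.map (fun x i => y i (x i))
      = (Measure.pi fun i => (volume : Measure ℝ).restrict (V i)).withDensity K) :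
    P = (Measure.pi ρ).withDensity fun x => K fun i => y i (x i) := by
  have hY : Measurable fun (x : ι → ℝ) i => y i (x i) :=
    measurable_pi_lambda _ fun i => (hy i).comp (measurable_pi_apply i)
  have : ∀ i, SigmaFinite ((ρ i).map (y i)) := fun i => by rw [hρ i]; infer_instance
  have hmap : (Measure.pi ρ).map (fun x i => y i (x i))
      = Measure.pi fun i => (volume : Measure ℝ).restrict (V i) := by
    rw [Measure.pi_map_pi fun i => (hy i).aemeasurable]
    simp_rw [hρ]
  have hρS' : ∀ᵐ x ∂Measure.pi ρ, ∀ i, x i ∈ S i := ae_all_iff.mpr fun i =>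
    Measure.tendsto_eval_ae_ae.eventually (mem_ae_iff.mpr (hρS i))
  have hlevel : ∀ ν : Measure (ι → ℝ), ν.map (fun x i => y i (x i)) ≪
      (Measure.pi fun i => (volume : Measure ℝ).restrict (V i)) →
      ∀ i c, ν {x | y i (x i) = c} = 0 := by
    intro ν hν i c
    have hm : MeasurableSet {u : ι → ℝ | u i = c} :=
      measurableSet_eq_fun (measurable_pi_apply i) measurable_const
    have := hν (Measure.pi_hyperplane (fun i => (volume : Measure ℝ).restrict (V i)) i c)
    rwa [Measure.map_apply hY hm] at this
  have hbox : ∀ B : Set (ι → ℝ), MeasurableSet B →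
      P ((fun x i => y i (x i)) ⁻¹' B) =
        (Measure.pi ρ).withDensity (fun x => K fun i => y i (x i))
          ((fun x i => y i (x i)) ⁻¹' B) := by
    intro B hB
    rw [← Measure.map_apply hY hB, hP, withDensity_apply _ hB, withDensity_apply _ (hY hB),
      ← hmap, setLIntegral_map hB hK hY]
  refine Measure.ext_of_Ici_pi (hbox univ MeasurableSet.univ) fun v => ?_
  have hA : MeasurableSet (pi univ fun i => y i '' (Ici (v i) ∩ S i)) :=
    MeasurableSet.univ_pi fun i =>
      (measurableSet_Ici.inter (hS i)).image_of_antitoneOn ((hanti i).mono inter_subset_right)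
  rw [measure_congr (Ici_ae_eq_preimage_image hanti hPS
    (hlevel P (hP ▸ withDensity_absolutelyContinuous _ _)) v), hbox _ hA]
  refine (measure_congr ?_).symm
  exact (withDensity_absolutelyContinuous _ _).ae_le
    (Ici_ae_eq_preimage_image hanti hρS' (hlevel _ hmap.absolutelyContinuous) v)

/-! ### Convergence in total variation from convergence of densities -/

/-- One half of Scheffé's lemma, for densities `K_n (Y_n x) ∏ q_{n,i} (x_i)`, the `K_n` converging
pointwise and the coordinate transformations `Y_n` converging together with their derivatives. The
functions `K_n` need not converge at moving points: replacing `K_n` by `K` is done in the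
coordinates `Y_n x`, and only then is `Y_n` replaced by `Y`. -/
theorem eventually_measure_le_add {q : ℕ → ι → ℝ → ℝ≥0∞} {q₀ : ι → ℝ → ℝ≥0∞}
    (hq : ∀ n i, Measurable (q n i)) (hq₀ : ∀ i, Measurable (q₀ i)) (hq₀' : ∀ i x, q₀ i x ≠ ∞)
    {Y : ℕ → (ι → ℝ) → ι → ℝ} {Y₀ : (ι → ℝ) → ι → ℝ} (hY : ∀ n, Measurable (Y n))
    (hY₀ : Measurable Y₀) {K : ℕ → (ι → ℝ) → ℝ≥0∞} {K₀ : (ι → ℝ) → ℝ≥0∞}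
    (hK : ∀ n, Measurable (K n)) (hK₀ : Measurable K₀) (hK₀' : ∀ v, K₀ v ≠ ∞)
    (hKlim : ∀ v, K₀ v ≠ 0 → Tendsto (fun n => K n v) atTop (𝓝 (K₀ v)))
    (hKint : ∫⁻ v, K₀ v ≠ ∞)
    (hmap : ∀ᶠ n in atTop,
      (volume.withDensity fun x : ι → ℝ => ∏ i, q n i (x i)).map (Y n) ≤ volume)
    (hlim : ∀ x, K₀ (Y₀ x) ≠ 0 → (∀ i, q₀ i (x i) ≠ 0) →
      Tendsto (fun n => K₀ (Y n x)) atTop (𝓝 (K₀ (Y₀ x))) ∧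
        ∀ i, Tendsto (fun n => q n i (x i)) atTop (𝓝 (q₀ i (x i))))
    {G : Measure (ι → ℝ)} [IsFiniteMeasure G] {F : ℕ → Measure (ι → ℝ)}
    (hG : G = volume.withDensity fun x => K₀ (Y₀ x) * ∏ i, q₀ i (x i))
    (hF : ∀ᶠ n in atTop, F n = volume.withDensity fun x => K n (Y n x) * ∏ i, q n i (x i))
    {ε : ℝ≥0∞} (hε : 0 < ε) :
    ∀ᶠ n in atTop, ∀ A, MeasurableSet A → G A ≤ F n A + ε := by
  have hqm : ∀ n, Measurable fun x : ι → ℝ => ∏ i, q n i (x i) := fun n =>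
    Finset.measurable_prod _ fun i _ => (hq n i).comp (measurable_pi_apply i)
  have hqm₀ : Measurable fun x : ι → ℝ => ∏ i, q₀ i (x i) :=
    Finset.measurable_prod _ fun i _ => (hq₀ i).comp (measurable_pi_apply i)
  set g : (ι → ℝ) → ℝ≥0∞ := fun x => K₀ (Y₀ x) * ∏ i, q₀ i (x i) with hgdef
  have hg : Measurable g := (hK₀.comp hY₀).mul hqm₀
  set h : ℕ → (ι → ℝ) → ℝ≥0∞ := fun n x => K₀ (Y n x) * ∏ i, q n i (x i) with hhdef
  have hh : ∀ n, Measurable (h n) := fun n => (hK₀.comp (hY n)).mul (hqm n)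
  have hgtop : ∀ x, g x ≠ ∞ := fun x =>
    ENNReal.mul_ne_top (hK₀' _) (ENNReal.prod_ne_top fun i _ => hq₀' i _)
  have hgint : ∫⁻ x, g x ≠ ∞ := by
    have := measure_ne_top G univ
    rwa [hG, withDensity_apply _ MeasurableSet.univ, Measure.restrict_univ] at this
  have h1 : Tendsto (fun n => ∫⁻ x, (g x - h n x)) atTop (𝓝 0) := by
    have := tendsto_lintegral_of_dominated_convergence (μ := volume)
      (F := fun n x => g x - h n x) (f := fun _ => 0) g (fun n => hg.sub (hh n))
      (fun n => ae_of_all _ fun x => tsub_le_self) hgint (ae_of_all _ fun x => ?_)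
    · simpa using this
    · by_cases hx : g x = 0
      · simp [hx]
      · obtain ⟨hx1, hx2⟩ := mul_ne_zero_iff.mp hx
        obtain ⟨l1, l2⟩ := hlim x hx1 fun i => Finset.prod_ne_zero_iff.mp hx2 i (Finset.mem_univ i)
        have l3 : Tendsto (fun n => h n x) atTop (𝓝 (g x)) :=
          ENNReal.Tendsto.mul l1 (Or.inl hx1)
            (ENNReal.tendsto_finsetProd_of_ne_top _ (fun i _ => l2 i) fun i _ => hq₀' i _)
            (Or.inr (hK₀' _))
        have := ENNReal.Tendsto.sub (tendsto_const_nhds (x := g x)) l3 (Or.inl (hgtop x))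
        simpa using this
  have h2 : Tendsto (fun n => ∫⁻ v, (K₀ v - K n v)) atTop (𝓝 0) := by
    have := tendsto_lintegral_of_dominated_convergence (μ := volume)
      (F := fun n v => K₀ v - K n v) (f := fun _ => 0) K₀ (fun n => hK₀.sub (hK n))
      (fun n => ae_of_all _ fun x => tsub_le_self) hKint (ae_of_all _ fun v => ?_)
    · simpa using this
    · by_cases hv : K₀ v = 0
      · simp [hv]
      · have := ENNReal.Tendsto.sub (tendsto_const_nhds (x := K₀ v)) (hKlim v hv)
          (Or.inl (hK₀' v))
        simpa using this
  have h12 := h1.add h2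
  rw [add_zero] at h12
  filter_upwards [h12.eventually (gt_mem_nhds hε), hmap, hF] with n hn hmapn hFn A hA
  have hKK : Measurable fun v => K₀ v - K n v := hK₀.sub (hK n)
  have hgh : Measurable fun x => g x - h n x := hg.sub (hh n)
  set f : (ι → ℝ) → ℝ≥0∞ := fun x => K n (Y n x) * ∏ i, q n i (x i) with hfdef
  have hf : Measurable f := ((hK n).comp (hY n)).mul (hqm n)
  have h3 : ∫⁻ x, (h n x - f x) ≤ ∫⁻ v, (K₀ v - K n v) := by
    calc ∫⁻ x, (h n x - f x)
        ≤ ∫⁻ x, (∏ i, q n i (x i)) * (K₀ (Y n x) - K n (Y n x)) := by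
          refine lintegral_mono fun x => ?_
          rw [tsub_le_iff_right, hhdef, hfdef]
          calc K₀ (Y n x) * ∏ i, q n i (x i)
              ≤ (K₀ (Y n x) - K n (Y n x) + K n (Y n x)) * ∏ i, q n i (x i) := by
                gcongr; exact le_tsub_add
            _ = _ := by ring
      _ = ∫⁻ v, (K₀ v - K n v) ∂(volume.withDensity fun x => ∏ i, q n i (x i)).map (Y n) := by
          rw [lintegral_map hKK (hY n)]
          exact (lintegral_withDensity_eq_lintegral_mul _ (hqm n) (hKK.comp (hY n))).symm
      _ ≤ _ := lintegral_mono' hmapn le_rfl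
  calc G A = ∫⁻ x in A, g x := by rw [hG, withDensity_apply _ hA]
    _ ≤ ∫⁻ x in A, (f x + ((g x - h n x) + (h n x - f x))) := by
        refine lintegral_mono fun x => ?_
        calc g x ≤ (g x - h n x) + h n x := le_tsub_add
          _ ≤ (g x - h n x) + ((h n x - f x) + f x) := by gcongr; exact le_tsub_add
          _ = _ := by ring
    _ = F n A + ∫⁻ x in A, ((g x - h n x) + (h n x - f x)) := by
        rw [lintegral_add_left hf, hFn, withDensity_apply _ hA]
    _ ≤ F n A + ∫⁻ x, ((g x - h n x) + (h n x - f x)) := by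
        exact add_le_add le_rfl (setLIntegral_le_lintegral _ _)
    _ = F n A + ((∫⁻ x, (g x - h n x)) + ∫⁻ x, (h n x - f x)) := by
        rw [lintegral_add_left hgh]
    _ ≤ F n A + ε := by
        gcongr
        exact (add_le_add le_rfl h3).trans hn.le

end MaxStable

/-! ### Remote contiguity of product measures -/

namespace MaxStable

variable {X : Type*} [MeasurableSpace X]

/-- If `P` has a density bounded by `J` with respect to `G` and is close to `G` in total variation,
then the second moment of this density is close to `1`. -/
lemma lintegral_rnDeriv_sq_le {P G : Measure X} [IsProbabilityMeasure P] [IsProbabilityMeasure G]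
    {J : ℝ≥0} (hJ : P ≤ J • G) {ε : ℝ≥0∞}
    (hε : ∀ A, MeasurableSet A → G A ≤ P A + ε) :
    ∫⁻ x, P.rnDeriv G x ^ 2 ∂G ≤ 1 + J * ε := by
  have hac : P ≪ G := Measure.absolutelyContinuous_of_le_smul hJ
  have hm : Measurable (P.rnDeriv G) := Measure.measurable_rnDeriv P G
  have hwd : G.withDensity (P.rnDeriv G) = P := Measure.withDensity_rnDeriv_eq P G hac
  have hle : ∀ᵐ x ∂G, P.rnDeriv G x ≤ J := by
    refine ae_le_of_forall_setLIntegral_le_of_sigmaFinite hm fun s hs _ => ?_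
    rw [← withDensity_apply _ hs, hwd, setLIntegral_const]
    exact hJ s
  set A : Set X := {x | 1 < P.rnDeriv G x} with hA
  have hAm : MeasurableSet A := measurableSet_lt measurable_const hm
  have hexc : ∫⁻ x, (P.rnDeriv G x - 1) ∂G ≤ ε := by
    have h1 : ∫⁻ x, (P.rnDeriv G x - 1) ∂G + G A = P A := by
      have : ∫⁻ x, (P.rnDeriv G x - 1) ∂G = ∫⁻ x in A, (P.rnDeriv G x - 1) ∂G := by
        rw [← lintegral_indicator hAm]
        refine lintegral_congr fun x => ?_
        by_cases hx : x ∈ A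
        · simp [hx]
        · have hx' : P.rnDeriv G x ≤ 1 := not_lt.mp fun h => hx h
          simp [hx, tsub_eq_zero_of_le hx']
      rw [this, ← setLIntegral_one, ← lintegral_add_right _ measurable_const]
      refine Eq.trans ?_ (congrArg (fun ν : Measure X => ν A) hwd)
      rw [withDensity_apply _ hAm]
      exact setLIntegral_congr_fun hAm fun x hx => tsub_add_cancel_of_le (le_of_lt hx)
    have h2 : P A ≤ G A + ε := by
      have e1 : P A + P Aᶜ = 1 := prob_add_prob_compl hAm
      have e2 : G A + G Aᶜ = 1 := prob_add_prob_compl hAm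
      have e3 : P A + P Aᶜ ≤ (G A + ε) + P Aᶜ := by
        rw [e1, ← e2]
        calc G A + G Aᶜ ≤ G A + (P Aᶜ + ε) := by gcongr; exact hε _ hAm.compl
          _ = _ := by ring
      exact (ENNReal.add_le_add_iff_right (measure_ne_top P _)).mp e3
    rw [← h1, add_comm] at h2
    exact (ENNReal.add_le_add_iff_left (measure_ne_top G _)).mp h2
  calc ∫⁻ x, P.rnDeriv G x ^ 2 ∂G
      ≤ ∫⁻ x, (P.rnDeriv G x + J * (P.rnDeriv G x - 1)) ∂G := by
        refine lintegral_mono_ae ?_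
        filter_upwards [hle] with x hx
        rcases le_total (P.rnDeriv G x) 1 with h | h
        · calc P.rnDeriv G x ^ 2 ≤ P.rnDeriv G x := by
                rw [sq]; exact mul_le_of_le_one_left' h
            _ ≤ _ := le_self_add
        · calc P.rnDeriv G x ^ 2 = P.rnDeriv G x * (1 + (P.rnDeriv G x - 1)) := by
                rw [add_tsub_cancel_of_le h, sq]
            _ = P.rnDeriv G x + P.rnDeriv G x * (P.rnDeriv G x - 1) := by ring
            _ ≤ _ := by gcongr
    _ = ∫⁻ x, P.rnDeriv G x ∂G + J * ∫⁻ x, (P.rnDeriv G x - 1) ∂G := by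
        rw [lintegral_add_left hm, lintegral_const_mul _ (hm.sub_const 1)]
    _ ≤ 1 + J * ε := by
        gcongr
        have : ∫⁻ x, P.rnDeriv G x ∂G = P univ := by
          rw [← setLIntegral_univ, ← withDensity_apply _ MeasurableSet.univ, hwd]
        rw [this, measure_univ]

/-- The Cauchy-Schwarz bound for the likelihood ratio of product measures. -/
lemma pi_sq_le {P G : Measure X} [IsProbabilityMeasure P] [IsProbabilityMeasure G] (hac : P ≪ G)
    (n : ℕ) {E : Set (Fin n → X)} (hE : MeasurableSet E) :
    (Measure.pi fun _ : Fin n => P) E ^ 2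
      ≤ (Measure.pi fun _ : Fin n => G) E * (∫⁻ x, P.rnDeriv G x ^ 2 ∂G) ^ n := by
  have hm : Measurable (P.rnDeriv G) := Measure.measurable_rnDeriv P G
  have hwd : G.withDensity (P.rnDeriv G) = P := Measure.withDensity_rnDeriv_eq P G hac
  have : IsProbabilityMeasure (G.withDensity (P.rnDeriv G)) := by rwa [hwd]
  have hpi : (Measure.pi fun _ : Fin n => P) =
      (Measure.pi fun _ : Fin n => G).withDensity fun x => ∏ i, P.rnDeriv G (x i) := by
    rw [← pi_withDensity (fun _ : Fin n => G) fun _ => hm]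
    simp_rw [hwd]
  have hprod : Measurable fun x : Fin n → X => ∏ i, P.rnDeriv G (x i) :=
    Finset.measurable_prod _ fun i _ => hm.comp (measurable_pi_apply i)
  have h := ENNReal.lintegral_mul_le_Lp_mul_Lq (Measure.pi fun _ : Fin n => G)
    Real.HolderConjugate.two_two
    (f := E.indicator 1) (g := fun x => ∏ i, P.rnDeriv G (x i))
    (measurable_one.indicator hE).aemeasurable hprod.aemeasurable
  have h1 : ∫⁻ x, ((E.indicator 1 : (Fin n → X) → ℝ≥0∞) *
      fun x : Fin n → X => ∏ i, P.rnDeriv G (x i)) x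
      ∂(Measure.pi fun _ : Fin n => G) = (Measure.pi fun _ : Fin n => P) E := by
    rw [hpi, withDensity_apply _ hE, ← lintegral_indicator hE]
    refine lintegral_congr fun x => ?_
    by_cases hx : x ∈ E <;> simp [hx]
  have h2 : ∫⁻ x, (E.indicator 1 x : ℝ≥0∞) ^ (2 : ℝ) ∂(Measure.pi fun _ : Fin n => G)
      = (Measure.pi fun _ : Fin n => G) E := by
    rw [← lintegral_indicator_one hE]
    refine lintegral_congr fun x => ?_
    by_cases hx : x ∈ E <;> simp [hx]
  have h3 : ∫⁻ x, (∏ i, P.rnDeriv G (x i)) ^ (2 : ℝ) ∂(Measure.pi fun _ : Fin n => G)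
      = (∫⁻ x, P.rnDeriv G x ^ 2 ∂G) ^ n := by
    have := lintegral_pi_prod (fun _ : Fin n => G) (f := fun _ x => P.rnDeriv G x ^ 2)
      fun _ => hm.pow_const 2
    simp only [Finset.prod_const, Finset.card_univ, Fintype.card_fin] at this
    rw [← this]
    refine lintegral_congr fun x => ?_
    rw [Finset.prod_pow, ENNReal.rpow_two]
  rw [h1, h2, h3] at h
  calc (Measure.pi fun _ : Fin n => P) E ^ 2
      ≤ ((Measure.pi fun _ : Fin n => G) E ^ (1 / (2 : ℝ)) *
          ((∫⁻ x, P.rnDeriv G x ^ 2 ∂G) ^ n) ^ (1 / (2 : ℝ))) ^ 2 := by gcongr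
    _ = _ := by
      rw [mul_pow, ← ENNReal.rpow_natCast, ← ENNReal.rpow_natCast (_ ^ (1 / (2 : ℝ))),
        ← ENNReal.rpow_mul, ← ENNReal.rpow_mul]
      norm_num

/-- Laws `P n` whose densities with respect to `G` are uniformly bounded and which converge to `G`
in total variation have products that are remotely contiguous with respect to those of `G`. -/
theorem remotelyContiguous_pi {P : ℕ → Measure X} [∀ n, IsProbabilityMeasure (P n)]
    {G : Measure X} [IsProbabilityMeasure G] {J : ℝ≥0}
    (hJ : ∀ᶠ n in atTop, P n ≤ J • G)
    (htv : ∀ ε : ℝ≥0∞, 0 < ε → ∀ᶠ n in atTop, ∀ A, MeasurableSet A → G A ≤ P n A + ε)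
    {c : ℝ} (hc : 0 < c) (b : ℝ) :
    RemotelyContiguous (fun n => Measure.pi fun _ : Fin n => P n)
      (fun n => Measure.pi fun _ : Fin n => G)
      (fun n => Real.exp (-c * (n : ℝ))) (fun n => (n : ℝ) ^ b) := by
  intro E hE hsmall
  -- The margin `δ` leaves the exponential rate `c / 2` after Cauchy-Schwarz.
  set δ : ℝ := (Real.exp (c / 2) - 1) / (J + 1) with hδ
  have hδpos : 0 < δ := by
    have : 1 < Real.exp (c / 2) := Real.one_lt_exp_iff.mpr (by linarith)
    have hJ0 : (0 : ℝ) ≤ J := J.2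
    exact div_pos (by linarith) (by linarith)
  have hexp : 1 + (J : ℝ) * δ ≤ Real.exp (c / 2) := by
    have hJ0 : (0 : ℝ) ≤ J := J.2
    have : (J + 1 : ℝ) * δ = Real.exp (c / 2) - 1 := by rw [hδ]; field_simp
    nlinarith
  have hbound : ∀ᶠ n in atTop, (Measure.pi fun _ : Fin n => P n).real (E n)
      ≤ Real.exp (-(c / 4) * (n : ℝ)) := by
    filter_upwards [hJ, htv (ENNReal.ofReal δ) (ENNReal.ofReal_pos.mpr hδpos),
      hsmall.bound one_pos] with n hn htvn hsn
    have h1 := pi_sq_le (Measure.absolutelyContinuous_of_le_smul hn) n (hE n)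
    have h2 := lintegral_rnDeriv_sq_le hn htvn
    have h3 : (1 : ℝ≥0∞) + J * ENNReal.ofReal δ ≤ ENNReal.ofReal (Real.exp (c / 2)) := by
      rw [← ENNReal.ofReal_one, ← ENNReal.ofReal_coe_nnreal, ← ENNReal.ofReal_mul J.coe_nonneg,
        ← ENNReal.ofReal_add zero_le_one (by positivity)]
      exact ENNReal.ofReal_le_ofReal hexp
    have h4 : (Measure.pi fun _ : Fin n => G) (E n) ≤ ENNReal.ofReal (Real.exp (-c * n)) := by
      rw [← ofReal_measureReal]
      refine ENNReal.ofReal_le_ofReal ?_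
      simpa [abs_of_nonneg measureReal_nonneg] using hsn
    have h5 : (Measure.pi fun _ : Fin n => P n) (E n) ^ 2
        ≤ ENNReal.ofReal (Real.exp (-(c / 4) * n) ^ 2) := by
      calc _ ≤ ENNReal.ofReal (Real.exp (-c * n)) * ENNReal.ofReal (Real.exp (c / 2)) ^ n :=
            h1.trans (by gcongr; exact h2.trans h3)
        _ = _ := by
            rw [← ENNReal.ofReal_pow (Real.exp_pos _).le, ← ENNReal.ofReal_mul (Real.exp_pos _).le,
              ← Real.exp_nat_mul, ← Real.exp_add, ← Real.exp_nat_mul]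
            congr 2
            push_cast
            ring
    rw [ENNReal.ofReal_pow (Real.exp_pos _).le] at h5
    have h6 := (ENNReal.pow_le_pow_left_iff two_ne_zero).mp h5
    exact ENNReal.toReal_le_of_le_ofReal (Real.exp_pos _).le h6
  have hc4 : 0 < c / 4 := by linarith
  have hlit := (isLittleO_exp_neg_mul_rpow_atTop hc4 b).comp_tendsto
    (tendsto_natCast_atTop_atTop (R := ℝ))
  refine IsBigO.trans_isLittleO (IsBigO.of_bound 1 ?_) hlit
  filter_upwards [hbound] with n hn
  simpa [abs_of_nonneg measureReal_nonneg] using hn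

end MaxStable

/-! ### Univariate distribution functions near their upper endpoint -/

namespace MaxStable

/-- A continuous distribution function on the line that is continuously differentiable where it
is neither `0` nor `1`. -/
structure SmoothCDF (φ : ℝ → ℝ) : Prop where
  mono : Monotone φ
  cont : Continuous φ
  tendsto_bot : Tendsto φ atBot (𝓝 0)
  tendsto_top : Tendsto φ atTop (𝓝 1)
  smooth : ContDiffOn ℝ 1 φ {z | 0 < φ z ∧ φ z < 1}

namespace SmoothCDF

variable {φ : ℝ → ℝ}

lemma le_one (h : SmoothCDF φ) (z : ℝ) : φ z ≤ 1 := h.mono.ge_of_tendsto h.tendsto_top z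

lemma isOpen_interior (h : SmoothCDF φ) : IsOpen {z | 0 < φ z ∧ φ z < 1} :=
  (isOpen_lt continuous_const h.cont).inter (isOpen_lt h.cont continuous_const)

lemma hasDerivAt (h : SmoothCDF φ) {z : ℝ} (h0 : 0 < φ z) (h1 : φ z < 1) :
    HasDerivAt φ (deriv φ z) z :=
  ((h.smooth.differentiableOn one_ne_zero).differentiableAt
    (h.isOpen_interior.mem_nhds ⟨h0, h1⟩)).hasDerivAt

lemma exists_eq (h : SmoothCDF φ) {u : ℝ} (h0 : 0 < u) (h1 : u < 1) : ∃ z, φ z = u := by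
  obtain ⟨a, ha⟩ := (h.tendsto_bot.eventually (gt_mem_nhds h0)).exists
  obtain ⟨b, hb⟩ := (h.tendsto_top.eventually (lt_mem_nhds h1)).exists
  exact mem_range_of_exists_le_of_exists_ge h.cont ⟨a, ha.le⟩ ⟨b, hb.le⟩

/-- The largest quantile: the value `u` is attained at a point `z` with `φ w ≤ u ↔ w ≤ z`. -/
lemma exists_le_iff (h : SmoothCDF φ) {u : ℝ} (h0 : 0 < u) (h1 : u < 1) :
    ∃ z, φ z = u ∧ ∀ w, φ w ≤ u ↔ w ≤ z := by
  obtain ⟨z, hz⟩ := h.exists_eq h0 h1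
  obtain ⟨b, hb⟩ := (h.tendsto_top.eventually (lt_mem_nhds h1)).exists
  have hbdd : BddAbove {w | φ w ≤ u} :=
    ⟨b, fun w hw => le_of_lt (h.mono.reflect_lt (lt_of_le_of_lt hw hb))⟩
  have hcl : IsClosed {w | φ w ≤ u} := isClosed_le h.cont continuous_const
  have hmem : sSup {w | φ w ≤ u} ∈ {w | φ w ≤ u} := hcl.csSup_mem ⟨z, hz.le⟩ hbdd
  refine ⟨sSup {w | φ w ≤ u}, le_antisymm hmem ?_, fun w => ⟨fun hw => le_csSup hbdd hw,
    fun hw => (h.mono hw).trans hmem⟩⟩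
  exact hz.symm.trans_le (h.mono (le_csSup hbdd hz.le))

lemma leftInv_eq (h : SmoothCDF φ) {u : ℝ} (h0 : 0 < u) (h1 : u < 1) :
    φ (leftInv φ u) = u := by
  obtain ⟨z, hz⟩ := h.exists_eq h0 h1
  obtain ⟨a, ha⟩ := (h.tendsto_bot.eventually (gt_mem_nhds h0)).exists
  have hbdd : BddBelow {w | u ≤ φ w} :=
    ⟨a, fun w hw => le_of_lt (h.mono.reflect_lt (lt_of_lt_of_le ha hw))⟩
  have hcl : IsClosed {w | u ≤ φ w} := isClosed_le continuous_const h.cont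
  have hmem : leftInv φ u ∈ {w | u ≤ φ w} := hcl.csInf_mem ⟨z, hz.ge⟩ hbdd
  exact le_antisymm ((h.mono (csInf_le hbdd hz.ge)).trans_eq hz) hmem

lemma coe_lt_upperEndpoint (h : SmoothCDF φ) {w : ℝ} :
    (w : EReal) < upperEndpoint φ ↔ φ w < 1 := by
  constructor
  · intro hw
    obtain ⟨_, ⟨z, hz, rfl⟩, hwz⟩ := lt_sSup_iff.mp hw
    exact (h.mono (EReal.coe_lt_coe_iff.mp hwz).le).trans_lt hz
  · intro hw
    have : ∀ᶠ z in 𝓝[>] w, φ z < 1 :=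
      (h.cont.tendsto w).eventually (gt_mem_nhds hw) |>.filter_mono nhdsWithin_le_nhds
    obtain ⟨z, hz, hwz⟩ := (this.and self_mem_nhdsWithin).exists
    exact (EReal.coe_lt_coe_iff.mpr hwz).trans_le (le_sSup ⟨z, hz, rfl⟩)

lemma exists_interior (h : SmoothCDF φ) : ∃ z, 0 < φ z ∧ φ z < 1 := by
  obtain ⟨z, hz⟩ := h.exists_eq (u := 1 / 2) (by norm_num) (by norm_num)
  exact ⟨z, by rw [hz]; norm_num, by rw [hz]; norm_num⟩

lemma eventually_toEndpoint (h : SmoothCDF φ) {p : ℝ → Prop} :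
    (∀ᶠ z in toEndpoint φ, p z) ↔ ∃ z₀, φ z₀ < 1 ∧ ∀ w, z₀ < w → φ w < 1 → p w := by
  obtain ⟨z₁, -, hz₁⟩ := h.exists_interior
  have hbot : (z₁ : EReal) < upperEndpoint φ := h.coe_lt_upperEndpoint.mpr hz₁
  rw [toEndpoint, eventually_comap]
  constructor
  · intro hev
    obtain ⟨l, hl, hsub⟩ := (mem_nhdsLT_iff_exists_Ioo_subset' hbot).mp hev
    obtain ⟨_, ⟨z₂, hz₂, rfl⟩, hlz⟩ := lt_sSup_iff.mp (mem_Iio.mp hl)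
    exact ⟨z₂, hz₂, fun w hw hw1 => hsub ⟨hlz.trans (EReal.coe_lt_coe_iff.mpr hw),
      h.coe_lt_upperEndpoint.mpr hw1⟩ w rfl⟩
  · rintro ⟨z₀, hz₀, hp⟩
    have := Ioo_mem_nhdsLT (h.coe_lt_upperEndpoint.mpr hz₀)
    filter_upwards [this] with b hb w hw
    subst hw
    exact hp w (EReal.coe_lt_coe_iff.mp hb.1) (h.coe_lt_upperEndpoint.mp hb.2)

lemma eventually_interior (h : SmoothCDF φ) : ∀ᶠ z in toEndpoint φ, 0 < φ z ∧ φ z < 1 := by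
  obtain ⟨z, h0, h1⟩ := h.exists_interior
  exact h.eventually_toEndpoint.mpr ⟨z, h1, fun w hw hw1 => ⟨h0.trans_le (h.mono hw.le), hw1⟩⟩

lemma toEndpoint_neBot (h : SmoothCDF φ) : (toEndpoint φ).NeBot := by
  refine ⟨fun hbot => ?_⟩
  have : ∀ᶠ z in toEndpoint φ, False := by rw [hbot]; trivial
  obtain ⟨z₀, hz₀, hF⟩ := h.eventually_toEndpoint.mp this
  have : ∀ᶠ z in 𝓝[>] z₀, φ z < 1 :=
    (h.cont.tendsto z₀).eventually (gt_mem_nhds hz₀) |>.filter_mono nhdsWithin_le_nhds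
  obtain ⟨z, hz, hwz⟩ := (this.and self_mem_nhdsWithin).exists
  exact hF z hwz hz

lemma tendsto_toEndpoint (h : SmoothCDF φ) {α : Type*} {l : Filter α} {p : α → ℝ}
    (h1 : ∀ z, φ z < 1 → ∀ᶠ m in l, z < p m) (h2 : ∀ᶠ m in l, φ (p m) < 1) :
    Tendsto p l (toEndpoint φ) := by
  intro s hs
  obtain ⟨z₀, hz₀, hz⟩ := h.eventually_toEndpoint.mp (show ∀ᶠ z in toEndpoint φ, z ∈ s from hs)
  change ∀ᶠ m in l, p m ∈ s
  filter_upwards [h1 z₀ hz₀, h2] with m hm1 hm2 using hz _ hm1 hm2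

lemma tendsto_uIcc_toEndpoint (h : SmoothCDF φ) {α : Type*} {l : Filter α} {p q : α → ℝ}
    (hp : Tendsto p l (toEndpoint φ)) (hq : Tendsto q l (toEndpoint φ)) {P : ℝ → Prop}
    (hP : ∀ᶠ z in toEndpoint φ, P z) : ∀ᶠ m in l, ∀ w ∈ uIcc (p m) (q m), P w := by
  obtain ⟨z₀, hz₀, hz⟩ := h.eventually_toEndpoint.mp hP
  have hev : ∀ᶠ w in toEndpoint φ, z₀ < w ∧ φ w < 1 :=
    h.eventually_toEndpoint.mpr ⟨z₀, hz₀, fun w hw hw1 => ⟨hw, hw1⟩⟩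
  filter_upwards [hp.eventually hev, hq.eventually hev] with m hm1 hm2 w hw
  refine hz w ((lt_min hm1.1 hm2.1).trans_le hw.1) ((h.mono hw.2).trans_lt ?_)
  rcases max_choice (p m) (q m) with h' | h' <;> rw [h']
  exacts [hm1.2, hm2.2]

/-- The quantiles of order `1 - 1/m`. -/
lemma quantile_eq (h : SmoothCDF φ) {m : ℕ} (hm : 2 ≤ m) :
    φ (leftInv φ (1 - 1 / (m : ℝ))) = 1 - 1 / (m : ℝ) := by
  have hm' : (2 : ℝ) ≤ m := by exact_mod_cast hm
  have h2 : 1 / (m : ℝ) < 1 := by rw [div_lt_one (by linarith)]; linarith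
  have h3 : 0 < 1 / (m : ℝ) := by positivity
  exact h.leftInv_eq (by linarith) (by linarith)

lemma tendsto_quantile (h : SmoothCDF φ) :
    Tendsto (fun m : ℕ => leftInv φ (1 - 1 / (m : ℝ))) atTop (toEndpoint φ) := by
  refine h.tendsto_toEndpoint (fun z hz => ?_) ?_
  · have hlim : Tendsto (fun m : ℕ => 1 - 1 / (m : ℝ)) atTop (𝓝 1) := by
      simpa using tendsto_one_div_atTop_nhds_zero_nat.const_sub (1 : ℝ)
    filter_upwards [hlim.eventually (lt_mem_nhds hz), eventually_ge_atTop 2] with m hm hm2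
    exact h.mono.reflect_lt (by rwa [h.quantile_eq hm2])
  · filter_upwards [eventually_ge_atTop 2] with m hm
    rw [h.quantile_eq hm]
    have : 0 < 1 / (m : ℝ) := by positivity
    linarith

end SmoothCDF

/-- Cauchy's mean value theorem, with endpoints in either order. -/
lemma exists_mem_uIcc_ratio {f f' g g' : ℝ → ℝ} {p q : ℝ}
    (hf : ∀ x ∈ uIcc p q, HasDerivAt f (f' x) x) (hg : ∀ x ∈ uIcc p q, HasDerivAt g (g' x) x) :
    ∃ c ∈ uIcc p q, (g q - g p) * f' c = (f q - f p) * g' c := by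
  have main : ∀ a b, a < b → uIcc a b ⊆ uIcc p q →
      ∃ c ∈ uIcc p q, (g b - g a) * f' c = (f b - f a) * g' c := by
    intro a b hab hsub
    have hI : ∀ x ∈ Icc a b, x ∈ uIcc p q := fun x hx => hsub (by rwa [uIcc_of_le hab.le])
    obtain ⟨c, hc, h⟩ := exists_ratio_hasDerivAt_eq_ratio_slope f f' hab
      (fun x hx => (hf x (hI x hx)).continuousAt.continuousWithinAt)
      (fun x hx => hf x (hI x (Ioo_subset_Icc_self hx))) g g'
      (fun x hx => (hg x (hI x hx)).continuousAt.continuousWithinAt)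
      (fun x hx => hg x (hI x (Ioo_subset_Icc_self hx)))
    exact ⟨c, hI c (Ioo_subset_Icc_self hc), h⟩
  rcases lt_trichotomy p q with h | h | h
  · exact main p q h le_rfl
  · exact ⟨p, left_mem_uIcc, by simp [h]⟩
  · obtain ⟨c, hc, e⟩ := main q p h (by rw [uIcc_comm])
    exact ⟨c, hc, by linarith⟩

/-- If the hazard rate `φ' / (1 - φ)` is asymptotic to `κ g'` near the upper endpoint and
`g (q_m) - g (p_m) → δ`, then `(1 - φ (q_m)) / (1 - φ (p_m)) → exp (-κ δ)`. -/
lemma SmoothCDF.tendsto_tail_ratio {φ : ℝ → ℝ} (h : SmoothCDF φ) {g g' : ℝ → ℝ} {κ δ : ℝ}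
    (hg : ∀ᶠ z in toEndpoint φ, HasDerivAt g (g' z) z ∧ g' z ≠ 0)
    (hκ : Tendsto (fun z => deriv φ z / ((1 - φ z) * g' z)) (toEndpoint φ) (𝓝 κ))
    {p q : ℕ → ℝ} (hp : Tendsto p atTop (toEndpoint φ)) (hq : Tendsto q atTop (toEndpoint φ))
    (hδ : Tendsto (fun m => g (q m) - g (p m)) atTop (𝓝 δ)) :
    Tendsto (fun m => (1 - φ (q m)) / (1 - φ (p m))) atTop (𝓝 (Real.exp (-(κ * δ)))) := by
  have hP := h.tendsto_uIcc_toEndpoint hp hq (hg.and h.eventually_interior)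
  have hex : ∀ m, ∃ c, (∀ w ∈ uIcc (p m) (q m), (HasDerivAt g (g' w) w ∧ g' w ≠ 0) ∧
      0 < φ w ∧ φ w < 1) → c ∈ uIcc (p m) (q m) ∧
      Real.log (1 - φ (q m)) - Real.log (1 - φ (p m))
        = -(deriv φ c / ((1 - φ c) * g' c) * (g (q m) - g (p m))) := by
    intro m
    by_cases hm : ∀ w ∈ uIcc (p m) (q m), (HasDerivAt g (g' w) w ∧ g' w ≠ 0) ∧ 0 < φ w ∧ φ w < 1
    · obtain ⟨c, hc, e⟩ := exists_mem_uIcc_ratio (f := fun z => Real.log (1 - φ z))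
        (f' := fun z => -deriv φ z / (1 - φ z)) (g := g) (g' := g')
        (fun x hx => ((h.hasDerivAt (hm x hx).2.1 (hm x hx).2.2).const_sub 1).log
          (by linarith [(hm x hx).2.2])) (fun x hx => (hm x hx).1.1)
      refine ⟨c, fun _ => ⟨hc, ?_⟩⟩
      have h1 : 1 - φ c ≠ 0 := by linarith [(hm c hc).2.2]
      have h2 := (hm c hc).1.2
      field_simp at e ⊢
      linarith
    · exact ⟨0, fun h => absurd h hm⟩
  choose c hc using hex
  have hcl : Tendsto c atTop (toEndpoint φ) := by
    intro s hs
    change ∀ᶠ m in atTop, c m ∈ s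
    filter_upwards [h.tendsto_uIcc_toEndpoint hp hq hs, hP] with m hm hPm
    exact hm _ (hc m hPm).1
  have hlog : Tendsto (fun m => Real.log (1 - φ (q m)) - Real.log (1 - φ (p m))) atTop
      (𝓝 (-(κ * δ))) := by
    refine (((hκ.comp hcl).mul hδ).neg).congr' ?_
    filter_upwards [hP] with m hm using ((hc m hm).2).symm
  refine ((Real.continuous_exp.tendsto _).comp hlog).congr' ?_
  filter_upwards [hP] with m hm
  have h1 : 0 < 1 - φ (q m) := by linarith [(hm (q m) right_mem_uIcc).2.2]
  have h2 : 0 < 1 - φ (p m) := by linarith [(hm (p m) left_mem_uIcc).2.2]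
  rw [Function.comp_apply, Real.exp_sub, Real.exp_log h1, Real.exp_log h2]

/-- Tails and densities of normalised maxima: under the assumptions of `tendsto_tail_ratio` with
the quantiles of order `1 - 1/m` in place of `p_m`, both `m (1 - φ (q_m))` and
`m a_m φ' (q_m)` converge. -/
lemma SmoothCDF.tendsto_normalised {φ : ℝ → ℝ} (h : SmoothCDF φ) {g g' : ℝ → ℝ} {κ δ τ : ℝ}
    (hg : ∀ᶠ z in toEndpoint φ, HasDerivAt g (g' z) z ∧ g' z ≠ 0)
    (hκ : Tendsto (fun z => deriv φ z / ((1 - φ z) * g' z)) (toEndpoint φ) (𝓝 κ))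
    {a q : ℕ → ℝ} (hq : Tendsto q atTop (toEndpoint φ))
    (hδ : Tendsto (fun m : ℕ => g (q m) - g (leftInv φ (1 - 1 / (m : ℝ)))) atTop (𝓝 δ))
    (hτ : Tendsto (fun m => a m * g' (q m)) atTop (𝓝 τ)) :
    Tendsto (fun m : ℕ => (m : ℝ) * (1 - φ (q m))) atTop (𝓝 (Real.exp (-(κ * δ)))) ∧
      Tendsto (fun m : ℕ => (m : ℝ) * (a m * deriv φ (q m))) atTop
        (𝓝 (Real.exp (-(κ * δ)) * κ * τ)) := by
  have h1 : Tendsto (fun m : ℕ => (m : ℝ) * (1 - φ (q m))) atTop (𝓝 (Real.exp (-(κ * δ)))) := by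
    refine (h.tendsto_tail_ratio hg hκ h.tendsto_quantile hq hδ).congr' ?_
    filter_upwards [eventually_ge_atTop 2] with m hm
    rw [h.quantile_eq hm]
    simp [div_eq_mul_inv, mul_comm]
  refine ⟨h1, ((h1.mul (hκ.comp hq)).mul hτ).congr' ?_⟩
  filter_upwards [hq.eventually (hg.and h.eventually_interior)] with m hm
  have h2 : 1 - φ (q m) ≠ 0 := by linarith [hm.2.2]
  have h3 := hm.1.2
  simp only [Function.comp_apply]
  field_simp

end MaxStable

/-! ### Normalised tails under the von Mises conditions -/

namespace MaxStable

/-- The open interval on which the margins of a max-stable law take values in `(0, 1)`. -/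
def marginSupp {d : ℕ} : MarginType d → Set ℝ
  | .frechet _ => Ioi 0
  | .weibull _ => Iio 0
  | .gumbel => univ

/-- The function `-log G_j` on the support of the `j`-th margin. -/
def marginTail {d : ℕ} : MarginType d → Fin d → ℝ → ℝ
  | .frechet ρ, j, x => x ^ (-ρ j)
  | .weibull ω, j, x => (-x) ^ ω j
  | .gumbel, _, x => Real.exp (-x)

/-- The negated derivative of `-log G_j` on the support of the `j`-th margin. -/
def marginTailDeriv {d : ℕ} : MarginType d → Fin d → ℝ → ℝ
  | .frechet ρ, j, x => ρ j * x ^ (-ρ j - 1)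
  | .weibull ω, j, x => ω j * (-x) ^ (ω j - 1)
  | .gumbel, _, x => Real.exp (-x)

section Frechet

lemma SmoothCDF.toEndpoint_eq_atTop {φ : ℝ → ℝ} (h : SmoothCDF φ) (h1 : ∀ z, φ z < 1) :
    toEndpoint φ = atTop := by
  ext s
  refine (h.eventually_toEndpoint (p := fun z => z ∈ s)).trans ?_
  rw [mem_atTop_sets]
  constructor
  · rintro ⟨z₀, -, hz⟩
    exact ⟨z₀ + 1, fun w hw => hz w (by linarith) (h1 w)⟩
  · rintro ⟨z₀, hz⟩
    exact ⟨z₀, h1 z₀, fun w hw _ => hz w hw.le⟩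

lemma tendsto_frechet {φ : ℝ → ℝ} (h : SmoothCDF φ) {ρ : ℝ} (hρ : 0 < ρ)
    (hv : Tendsto (fun z => z * deriv φ z / (1 - φ z)) atTop (𝓝 ρ)) :
    (∀ᶠ m : ℕ in atTop, 0 < leftInv φ (1 - 1 / (m : ℝ))) ∧ ∀ x : ℝ, 0 < x →
      Tendsto (fun m : ℕ => (m : ℝ) * (1 - φ (leftInv φ (1 - 1 / (m : ℝ)) * x + 0))) atTop
        (𝓝 (x ^ (-ρ))) ∧
      Tendsto (fun m : ℕ => (m : ℝ) * (leftInv φ (1 - 1 / (m : ℝ)) *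
        deriv φ (leftInv φ (1 - 1 / (m : ℝ)) * x + 0))) atTop (𝓝 (ρ * x ^ (-ρ - 1))) := by
  have h1 : ∀ z, φ z < 1 := by
    intro z
    obtain ⟨w, hw, hzw⟩ :=
      ((hv.eventually (lt_mem_nhds hρ)).and (eventually_ge_atTop z)).exists
    refine (h.mono hzw).trans_lt (lt_of_le_of_ne (h.le_one w) fun heq => ?_)
    simp [heq] at hw
  have htop := h.toEndpoint_eq_atTop h1
  have ht := h.tendsto_quantile
  rw [htop] at ht
  have hpos := ht.eventually_gt_atTop 0
  refine ⟨hpos, fun x hx => ?_⟩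
  have := h.tendsto_normalised (g := Real.log) (g' := fun z => z⁻¹) (κ := ρ) (δ := Real.log x)
    (τ := x⁻¹) (a := fun m : ℕ => leftInv φ (1 - 1 / (m : ℝ)))
    (q := fun m : ℕ => leftInv φ (1 - 1 / (m : ℝ)) * x + 0) ?_ ?_ ?_ ?_ ?_
  · have e : Real.exp (-(ρ * Real.log x)) = x ^ (-ρ) := by
      rw [Real.rpow_def_of_pos hx]; congr 1; ring
    rw [e] at this
    refine ⟨this.1, ?_⟩
    have e2 : ρ * x ^ (-ρ - 1) = x ^ (-ρ) * ρ * x⁻¹ := by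
      rw [Real.rpow_sub_one hx.ne']; field_simp
    rw [e2]
    exact this.2
  · rw [htop]
    filter_upwards [eventually_gt_atTop 0] with z hz
    exact ⟨Real.hasDerivAt_log hz.ne', inv_ne_zero hz.ne'⟩
  · rw [htop]
    refine hv.congr fun z => ?_
    rw [div_mul_eq_div_div, div_inv_eq_mul]
    ring
  · rw [htop]
    simpa using ht.atTop_mul_const hx
  · refine tendsto_const_nhds.congr' ?_
    filter_upwards [hpos] with m hm
    rw [add_zero, Real.log_mul hm.ne' hx.ne']
    ring
  · refine tendsto_const_nhds.congr' ?_
    filter_upwards [hpos] with m hm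
    rw [add_zero]
    field_simp

end Frechet

section Weibull

lemma tendsto_weibull {φ : ℝ → ℝ} (h : SmoothCDF φ) {ω : ℝ} (hfin : upperEndpoint φ ≠ ⊤)
    (hv : Tendsto (fun z => ((upperEndpoint φ).toReal - z) * deriv φ z / (1 - φ z))
      (toEndpoint φ) (𝓝 ω)) :
    (∀ᶠ m : ℕ in atTop, 0 < (upperEndpoint φ).toReal - leftInv φ (1 - 1 / (m : ℝ))) ∧
    ∀ x : ℝ, x < 0 →
      Tendsto (fun m : ℕ => (m : ℝ) * (1 - φ (((upperEndpoint φ).toReal -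
        leftInv φ (1 - 1 / (m : ℝ))) * x + (upperEndpoint φ).toReal))) atTop (𝓝 ((-x) ^ ω)) ∧
      Tendsto (fun m : ℕ => (m : ℝ) * (((upperEndpoint φ).toReal -
        leftInv φ (1 - 1 / (m : ℝ))) * deriv φ (((upperEndpoint φ).toReal -
        leftInv φ (1 - 1 / (m : ℝ))) * x + (upperEndpoint φ).toReal))) atTop
        (𝓝 (ω * (-x) ^ (ω - 1))) := by
  obtain ⟨z₁, -, hz₁⟩ := h.exists_interior
  have hne : upperEndpoint φ ≠ ⊥ := ((bot_le).trans_lt (h.coe_lt_upperEndpoint.mpr hz₁)).ne'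
  set e := (upperEndpoint φ).toReal with he
  have hlt : ∀ w, φ w < 1 ↔ w < e := fun w => by
    rw [← h.coe_lt_upperEndpoint, ← EReal.coe_toReal hfin hne, EReal.coe_lt_coe_iff]
  have hev : ∀ {p : ℝ → Prop}, (∀ᶠ z in toEndpoint φ, p z) → ∃ z₀ < e, ∀ w, z₀ < w → w < e → p w :=
    fun hp => by
      obtain ⟨z₀, hz₀, hp'⟩ := h.eventually_toEndpoint.mp hp
      exact ⟨z₀, (hlt _).mp hz₀, fun w hw hw1 => hp' w hw ((hlt w).mpr hw1)⟩
  have hbelow : ∀ᶠ z in toEndpoint φ, z < e :=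
    h.eventually_interior.mono fun z hz => (hlt z).mp hz.2
  have htq := h.tendsto_quantile
  have hpos : ∀ᶠ m : ℕ in atTop, 0 < e - leftInv φ (1 - 1 / (m : ℝ)) :=
    (htq.eventually hbelow).mono fun m hm => sub_pos.mpr hm
  have hnear : ∀ z < e, ∀ᶠ m : ℕ in atTop, z < leftInv φ (1 - 1 / (m : ℝ)) := fun z hz =>
    htq.eventually (h.eventually_toEndpoint.mpr ⟨z, (hlt z).mpr hz, fun w hw _ => hw⟩)
  refine ⟨hpos, fun x hx => ?_⟩
  have := h.tendsto_normalised (g := fun z => -Real.log (e - z)) (g' := fun z => (e - z)⁻¹)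
    (κ := ω) (δ := -Real.log (-x)) (τ := (-x)⁻¹)
    (a := fun m : ℕ => e - leftInv φ (1 - 1 / (m : ℝ)))
    (q := fun m : ℕ => (e - leftInv φ (1 - 1 / (m : ℝ))) * x + e) ?_ ?_ ?_ ?_ ?_
  · have e1 : Real.exp (-(ω * -Real.log (-x))) = (-x) ^ ω := by
      rw [Real.rpow_def_of_pos (neg_pos.mpr hx)]; congr 1; ring
    rw [e1] at this
    refine ⟨this.1, ?_⟩
    have e2 : ω * (-x) ^ (ω - 1) = (-x) ^ ω * ω * (-x)⁻¹ := by
      rw [Real.rpow_sub_one (neg_pos.mpr hx).ne']; ring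
    rw [e2]
    exact this.2
  · filter_upwards [hbelow] with z hz
    have hz' : e - z ≠ 0 := by linarith
    refine ⟨?_, inv_ne_zero hz'⟩
    have := (((hasDerivAt_id z).const_sub e).log hz').fun_neg
    simpa [neg_div] using this
  · refine hv.congr fun z => ?_
    rw [div_mul_eq_div_div, div_inv_eq_mul]
    ring
  · refine h.tendsto_toEndpoint (fun z hz => ?_) ?_
    · have hz' := (hlt z).mp hz
      -- `z < e + (e - t) x` holds once `t` is within `(e - z) / (-x)` of `e`.
      have hw : e - (e - z) / (-x) < e := by
        have : 0 < (e - z) / (-x) := div_pos (by linarith) (by linarith)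
        linarith
      filter_upwards [hnear _ hw] with m hm
      have h1 : e - leftInv φ (1 - 1 / (m : ℝ)) < (e - z) / (-x) := by linarith
      rw [lt_div_iff₀ (by linarith)] at h1
      linarith
    · filter_upwards [hpos] with m hm
      exact (hlt _).mpr (by nlinarith)
  · refine tendsto_const_nhds.congr' ?_
    filter_upwards [hpos] with m hm
    have : e - ((e - leftInv φ (1 - 1 / (m : ℝ))) * x + e)
        = (e - leftInv φ (1 - 1 / (m : ℝ))) * (-x) := by ring
    rw [this, Real.log_mul hm.ne' (by linarith)]
    ring
  · refine tendsto_const_nhds.congr' ?_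
    filter_upwards [hpos] with m hm
    have : e - ((e - leftInv φ (1 - 1 / (m : ℝ))) * x + e)
        = (e - leftInv φ (1 - 1 / (m : ℝ))) * (-x) := by ring
    rw [this, mul_inv, ← mul_assoc, mul_inv_cancel₀ hm.ne', one_mul]

end Weibull

section Gumbel

variable {φ : ℝ → ℝ}

/-- The mean excess function `∫_z^∞ (1 - φ) / (1 - φ z)`, which is the scale of Gumbel maxima. -/
def meanExcess (φ : ℝ → ℝ) (z : ℝ) : ℝ := (∫ t in Ioi z, (1 - φ t)) / (1 - φ z)

lemma SmoothCDF.hasDerivAt_tailIntegral (h : SmoothCDF φ) {z₁ z : ℝ}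
    (hint : IntegrableOn (fun t => 1 - φ t) (Ioi z₁)) (hz : z₁ < z) :
    HasDerivAt (fun w => ∫ t in Ioi w, (1 - φ t)) (-(1 - φ z)) z := by
  have hcont : Continuous fun t => 1 - φ t := continuous_const.sub h.cont
  have hd : HasDerivAt (fun w => (∫ t in Ioi z₁, (1 - φ t)) - ∫ t in z₁..w, (1 - φ t))
      (-(1 - φ z)) z := by
    simpa using (hcont.integral_hasStrictDerivAt z₁ z).hasDerivAt.const_sub
      (∫ t in Ioi z₁, (1 - φ t))
  refine hd.congr_of_eventuallyEq ?_
  filter_upwards [lt_mem_nhds hz] with w hw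
  have := intervalIntegral.integral_interval_add_Ioi hint
    (hint.mono_set (Ioi_subset_Ioi hw.le))
  linarith

lemma SmoothCDF.meanExcess_le (h : SmoothCDF φ) {e v : ℝ} (he : φ e = 1) (hv : v ≤ e)
    (hv1 : φ v < 1) : meanExcess φ v ≤ e - v := by
  rw [meanExcess, div_le_iff₀ (by linarith)]
  have h1 : ∫ t in Ioi v, (1 - φ t) = ∫ t in Ioc v e, (1 - φ t) := by
    refine setIntegral_eq_of_subset_of_forall_sdiff_eq_zero measurableSet_Ioi
      Ioc_subset_Ioi_self fun t ht => ?_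
    have : e < t := by
      by_contra hle
      exact ht.2 ⟨ht.1, not_lt.mp hle⟩
    have := h.mono this.le
    linarith [h.le_one t]
  rw [h1]
  have h2 := norm_setIntegral_le_of_norm_le_const (μ := volume) (s := Ioc v e)
    (f := fun t => 1 - φ t) (C := 1 - φ v) (by simp) fun t ht => by
      rw [Real.norm_eq_abs, abs_of_nonneg (by linarith [h.le_one t])]
      linarith [h.mono ht.1.le]
  rw [Real.volume_real_Ioc_of_le hv] at h2
  linarith [le_abs_self (∫ t in Ioc v e, (1 - φ t)),
    Real.norm_eq_abs (∫ t in Ioc v e, (1 - φ t))]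

lemma SmoothCDF.exists_endpoint (h : SmoothCDF φ) {w : ℝ} (hw : φ w = 1) :
    ∃ e, φ e = 1 ∧ ∀ z < e, φ z < 1 := by
  obtain ⟨z₁, -, hz₁⟩ := h.exists_interior
  have hbdd : BddBelow {z | 1 ≤ φ z} :=
    ⟨z₁, fun z hz => (h.mono.reflect_lt (hz₁.trans_le hz)).le⟩
  have hmem : sInf {z | 1 ≤ φ z} ∈ {z | 1 ≤ φ z} :=
    (isClosed_le continuous_const h.cont).csInf_mem ⟨w, hw.ge⟩ hbdd
  refine ⟨_, le_antisymm (h.le_one _) hmem, fun z hz => ?_⟩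
  by_contra hz1
  exact absurd (csInf_le hbdd (not_lt.mp hz1)) (not_le.mpr hz)

variable (h : SmoothCDF φ)
  (hv : Tendsto (fun z => deriv φ z / (1 - φ z) ^ 2 * ∫ t in Ioi z, (1 - φ t))
    (toEndpoint φ) (𝓝 1))
include h hv

lemma eventually_gumbel :
    ∀ᶠ z in toEndpoint φ, (0 < φ z ∧ φ z < 1) ∧ 0 < ∫ t in Ioi z, (1 - φ t) ∧
      HasDerivAt (fun w => ∫ t in Ioi w, (1 - φ t)) (-(1 - φ z)) z := by
  have hpos : ∀ᶠ z in toEndpoint φ, 0 < ∫ t in Ioi z, (1 - φ t) := by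
    filter_upwards [hv.eventually (lt_mem_nhds one_pos)] with z hz
    refine lt_of_le_of_ne (integral_nonneg fun t => by simpa using h.le_one t) fun h0 => ?_
    rw [← h0] at hz
    simp at hz
  have := h.toEndpoint_neBot
  obtain ⟨z₁, hz₁, hz₁'⟩ := (hpos.and h.eventually_interior).exists
  have hint : IntegrableOn (fun t => 1 - φ t) (Ioi z₁) := by
    by_contra hni
    exact hz₁.ne' (integral_undef hni)
  filter_upwards [h.eventually_interior, hpos,
    h.eventually_toEndpoint.mpr ⟨z₁, hz₁'.2, fun w hw _ => hw⟩] with z hz hz' hz1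
  exact ⟨hz, hz', h.hasDerivAt_tailIntegral hint hz1⟩

lemma eventually_meanExcess {ε : ℝ} (hε : 0 < ε) :
    ∀ᶠ z in toEndpoint φ, 0 < meanExcess φ z ∧
      ∃ B, |B| ≤ ε ∧ HasDerivAt (meanExcess φ) B z := by
  have hB : Tendsto (fun z => deriv φ z / (1 - φ z) ^ 2 * (∫ t in Ioi z, (1 - φ t)) - 1)
      (toEndpoint φ) (𝓝 0) := by simpa using hv.sub_const 1
  filter_upwards [eventually_gumbel h hv, hB.eventually (Metric.closedBall_mem_nhds 0 hε)]
    with z hz hz'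
  have h1 : 1 - φ z ≠ 0 := by linarith [hz.1.2]
  refine ⟨div_pos hz.2.1 (by linarith [hz.1.2]), _, by simpa using hz', ?_⟩
  have := hz.2.2.div ((h.hasDerivAt hz.1.1 hz.1.2).const_sub 1) h1
  convert! this using 1
  field_simp
  ring

/-- The mean excess function is self-neglecting: points at a bounded number of mean excesses from
`z` remain near the endpoint when `z` does. -/
lemma tendsto_add_meanExcess (x : ℝ) :
    Tendsto (fun z => z + meanExcess φ z * x) (toEndpoint φ) (toEndpoint φ) := by
  have hneBot := h.toEndpoint_neBot
  -- The slope of the mean excess function is eventually at most `ε`, where `ε |x| ≤ 1 / 2`.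
  set ε : ℝ := 1 / (2 * (|x| + 1)) with hεdef
  have hx0 := abs_nonneg x
  have hε : 0 < ε := by positivity
  have hεx : ε * |x| ≤ 1 / 2 := by
    rw [hεdef, div_mul_eq_mul_div, div_le_div_iff₀ (by positivity) (by norm_num)]
    linarith
  obtain ⟨z₀, hz₀, hA⟩ := h.eventually_toEndpoint.mp (eventually_meanExcess h hv hε)
  have hlip : ∀ u v, z₀ < u → u ≤ v → φ v < 1 →
      |meanExcess φ v - meanExcess φ u| ≤ ε * (v - u) := by
    intro u v hu huv hv1
    have hin : ∀ w ∈ Icc u v, z₀ < w ∧ φ w < 1 := fun w hw =>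
      ⟨hu.trans_le hw.1, (h.mono hw.2).trans_lt hv1⟩
    have := (convex_Icc u v).norm_image_sub_le_of_norm_deriv_le (f := meanExcess φ) (C := ε)
      (fun w hw => by
        obtain ⟨-, B, -, hd⟩ := hA w (hin w hw).1 (hin w hw).2
        exact hd.differentiableAt)
      (fun w hw => by
        obtain ⟨-, B, hB, hd⟩ := hA w (hin w hw).1 (hin w hw).2
        rwa [hd.deriv]) (left_mem_Icc.mpr huv) (right_mem_Icc.mpr huv)
    rwa [Real.norm_eq_abs, Real.norm_eq_abs, abs_of_nonneg (sub_nonneg.mpr huv)] at this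
  have hgt : ∀ w, φ w < 1 → ∀ᶠ z in toEndpoint φ, w < z ∧ φ z < 1 := fun w hw =>
    h.eventually_toEndpoint.mpr ⟨w, hw, fun z hz hz1 => ⟨hz, hz1⟩⟩
  refine h.tendsto_toEndpoint (fun w hw => ?_) ?_
  · by_cases hend : ∃ e, φ e = 1
    · obtain ⟨e, he, hlt⟩ := h.exists_endpoint hend.choose_spec
      have hwe : w < e := h.mono.reflect_lt (by rwa [he])
      have hw' : φ (e - (e - w) / (|x| + 1)) < 1 :=
        hlt _ (sub_lt_self _ (div_pos (sub_pos.mpr hwe) (by positivity)))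
      filter_upwards [hgt _ hw', hgt z₀ hz₀] with z hz hz'
      have hze : z < e := h.mono.reflect_lt (by rw [he]; exact hz.2)
      have h1 := h.meanExcess_le he hze.le hz.2
      have h2 : 0 < meanExcess φ z := (hA z hz'.1 hz'.2).1
      have h3 : (e - z) < (e - w) / (|x| + 1) := by linarith [hz.1]
      rw [lt_div_iff₀ (by positivity)] at h3
      have h4 : meanExcess φ z * |x| ≤ (e - z) * |x| := by gcongr
      have h5 : -(meanExcess φ z * |x|) ≤ meanExcess φ z * x := by
        rw [← mul_neg]; exact mul_le_mul_of_nonneg_left (neg_abs_le x) h2.le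
      linarith
    · push Not at hend
      have h1 : ∀ z, φ z < 1 := fun z => lt_of_le_of_ne (h.le_one z) (hend z)
      set u := max w z₀ + 1 with hu
      have huw : w < u := by linarith [le_max_left w z₀]
      have hu0 : z₀ < u := by linarith [le_max_right w z₀]
      filter_upwards [hgt (u + 2 * (meanExcess φ u * |x|)) (h1 _), hgt u (h1 _)] with z hz hzu
      have h2 := (abs_le.mp (hlip u z hu0 hzu.1.le hzu.2)).2
      have h3 : 0 < meanExcess φ z := (hA z (hu0.trans hzu.1) hzu.2).1
      have h5 : -(meanExcess φ z * |x|) ≤ meanExcess φ z * x := by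
        rw [← mul_neg]; exact mul_le_mul_of_nonneg_left (neg_abs_le x) h3.le
      have h6 : meanExcess φ z * |x| ≤ (meanExcess φ u + ε * (z - u)) * |x| := by
        gcongr; linarith
      have h7 : (z - u) * (ε * |x|) ≤ (z - u) * (1 / 2) := by
        have : 0 ≤ z - u := by linarith [hzu.1]
        gcongr
      linarith [hz.1]
  · filter_upwards [hgt z₀ hz₀] with z hz
    have hApos : 0 < meanExcess φ z := (hA z hz.1 hz.2).1
    by_contra hge
    have he1 : φ (z + meanExcess φ z * x) = 1 := le_antisymm (h.le_one _) (not_lt.mp hge)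
    obtain ⟨e, he, hlt⟩ := h.exists_endpoint he1
    have hze : z < e := h.mono.reflect_lt (by rw [he]; exact hz.2)
    have hex : e ≤ z + meanExcess φ z * x := not_lt.mp fun hlt' => hge (hlt _ hlt')
    -- At `v`, close to `e`, the mean excess is at least half of that at `z`, yet at most `e - v`.
    set v := e - min (meanExcess φ z / 4) ((e - z) / 2) with hvdef
    have hv1 : min (meanExcess φ z / 4) ((e - z) / 2) ≤ meanExcess φ z / 4 := min_le_left _ _
    have hv2 : min (meanExcess φ z / 4) ((e - z) / 2) ≤ (e - z) / 2 := min_le_right _ _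
    have hv3 : 0 < min (meanExcess φ z / 4) ((e - z) / 2) :=
      lt_min (by linarith) (by linarith)
    have hve : v < e := by linarith
    have h1 := h.meanExcess_le he hve.le (hlt v hve)
    have h2 := (abs_le.mp (hlip z v hz.1 (by linarith) (hlt v hve))).1
    have h3 : ε * (v - z) ≤ ε * (meanExcess φ z * x) := by gcongr; linarith
    have h4 : meanExcess φ z * (ε * x) ≤ meanExcess φ z * (1 / 2) := by
      gcongr
      exact (mul_le_mul_of_nonneg_left (le_abs_self x) hε.le).trans hεx
    linarith

lemma eventually_meanExcess_ratio (x : ℝ) {t : ℕ → ℝ} (ht : Tendsto t atTop (toEndpoint φ))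
    {ε : ℝ} (hε : 0 < ε) :
    ∀ᶠ m in atTop, ∀ ξ ∈ uIcc (t m) (t m + meanExcess φ (t m) * x),
      |meanExcess φ ξ / meanExcess φ (t m) - 1| ≤ ε := by
  have hx0 := abs_nonneg x
  have hε' : 0 < ε / (|x| + 1) := by positivity
  have hq := (tendsto_add_meanExcess h hv x).comp ht
  filter_upwards [h.tendsto_uIcc_toEndpoint ht hq (eventually_meanExcess h hv hε')] with m hm ξ hξ
  have hA : 0 < meanExcess φ (t m) := (hm _ left_mem_uIcc).1
  have h1 := (convex_uIcc (t m) (t m + meanExcess φ (t m) * x)).norm_image_sub_le_of_norm_deriv_le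
      (f := meanExcess φ) (C := ε / (|x| + 1))
      (fun w hw => by
        obtain ⟨-, B, -, hd⟩ := hm w hw
        exact hd.differentiableAt)
      (fun w hw => by
        obtain ⟨-, B, hB, hd⟩ := hm w hw
        rwa [hd.deriv]) left_mem_uIcc hξ
  have h2 : |ξ - t m| ≤ meanExcess φ (t m) * |x| := by
    have := abs_sub_left_of_mem_uIcc hξ
    rwa [add_sub_cancel_left, abs_mul, abs_of_pos hA] at this
  rw [Real.norm_eq_abs, Real.norm_eq_abs] at h1
  rw [div_sub_one hA.ne', abs_div, abs_of_pos hA, div_le_iff₀ hA]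
  calc _ ≤ ε / (|x| + 1) * (meanExcess φ (t m) * |x|) := h1.trans (by gcongr)
    _ = ε * meanExcess φ (t m) * (|x| / (|x| + 1)) := by ring
    _ ≤ ε * meanExcess φ (t m) * 1 := by
        gcongr
        rw [div_le_one (by positivity)]
        linarith
    _ = _ := mul_one _

lemma tendsto_meanExcess_ratio (x : ℝ) {t ξ : ℕ → ℝ} (ht : Tendsto t atTop (toEndpoint φ))
    (hξ : ∀ᶠ m in atTop, ξ m ∈ uIcc (t m) (t m + meanExcess φ (t m) * x)) :
    Tendsto (fun m => meanExcess φ (t m) / meanExcess φ (ξ m)) atTop (𝓝 1) := by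
  have : Tendsto (fun m => meanExcess φ (ξ m) / meanExcess φ (t m)) atTop (𝓝 1) := by
    rw [Metric.tendsto_nhds]
    intro ε hε
    filter_upwards [eventually_meanExcess_ratio h hv x ht (half_pos hε), hξ] with m hm hm'
    exact (hm _ hm').trans_lt (half_lt_self hε)
  simpa using this.inv₀ one_ne_zero

lemma tendsto_gumbel :
    (∀ᶠ m : ℕ in atTop, 0 < (m : ℝ) * ∫ z in Ioi (leftInv φ (1 - 1 / (m : ℝ))), (1 - φ z)) ∧
    ∀ x : ℝ,
      Tendsto (fun m : ℕ => (m : ℝ) * (1 - φ (((m : ℝ) *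
        ∫ z in Ioi (leftInv φ (1 - 1 / (m : ℝ))), (1 - φ z)) * x + leftInv φ (1 - 1 / (m : ℝ)))))
        atTop (𝓝 (Real.exp (-x))) ∧
      Tendsto (fun m : ℕ => (m : ℝ) * (((m : ℝ) *
        ∫ z in Ioi (leftInv φ (1 - 1 / (m : ℝ))), (1 - φ z)) * deriv φ (((m : ℝ) *
        ∫ z in Ioi (leftInv φ (1 - 1 / (m : ℝ))), (1 - φ z)) * x + leftInv φ (1 - 1 / (m : ℝ)))))
        atTop (𝓝 (Real.exp (-x))) := by
  have ht := h.tendsto_quantile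
  have hscale : ∀ᶠ m : ℕ in atTop,
      (m : ℝ) * ∫ z in Ioi (leftInv φ (1 - 1 / (m : ℝ))), (1 - φ z)
        = meanExcess φ (leftInv φ (1 - 1 / (m : ℝ))) := by
    filter_upwards [eventually_ge_atTop 2] with m hm
    rw [meanExcess, h.quantile_eq hm]
    simp [mul_comm]
  have hev := ht.eventually (eventually_meanExcess h hv one_pos)
  refine ⟨?_, fun x => ?_⟩
  · filter_upwards [hscale, hev] with m hm hm'
    rw [hm]
    exact hm'.1
  have hq : Tendsto (fun m : ℕ => leftInv φ (1 - 1 / (m : ℝ)) +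
      meanExcess φ (leftInv φ (1 - 1 / (m : ℝ))) * x) atTop (toEndpoint φ) :=
    (tendsto_add_meanExcess h hv x).comp ht
  -- The mean excess function is `-1 / (log I)'` for the tail integral `I` of `1 - φ`.
  have hg : ∀ᶠ z in toEndpoint φ,
      HasDerivAt (fun z => -Real.log (∫ t in Ioi z, (1 - φ t))) (meanExcess φ z)⁻¹ z ∧
        (meanExcess φ z)⁻¹ ≠ 0 := by
    filter_upwards [eventually_gumbel h hv, eventually_meanExcess h hv one_pos] with z hz hz'
    refine ⟨?_, inv_ne_zero hz'.1.ne'⟩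
    have := (hz.2.2.log hz.2.1.ne').fun_neg
    rwa [neg_div, neg_neg, ← inv_div] at this
  have hmain := h.tendsto_normalised (g := fun z => -Real.log (∫ t in Ioi z, (1 - φ t)))
    (g' := fun z => (meanExcess φ z)⁻¹) (κ := 1) (δ := x) (τ := 1)
    (a := fun m : ℕ => meanExcess φ (leftInv φ (1 - 1 / (m : ℝ)))) hg ?_ hq ?_ ?_
  · rw [one_mul, mul_one, mul_one] at hmain
    refine ⟨hmain.1.congr' ?_, hmain.2.congr' ?_⟩ <;>
    · filter_upwards [hscale] with m hm
      rw [hm, add_comm]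
  · refine hv.congr fun z => ?_
    rw [meanExcess, div_mul_eq_div_div, div_inv_eq_mul, sq, div_mul_eq_div_div]
    ring
  · have hP := h.tendsto_uIcc_toEndpoint ht hq hg
    have hex : ∀ m : ℕ, ∃ c, (∀ w ∈ uIcc (leftInv φ (1 - 1 / (m : ℝ)))
        (leftInv φ (1 - 1 / (m : ℝ)) + meanExcess φ (leftInv φ (1 - 1 / (m : ℝ))) * x),
        HasDerivAt (fun z => -Real.log (∫ t in Ioi z, (1 - φ t))) (meanExcess φ w)⁻¹ w ∧
          (meanExcess φ w)⁻¹ ≠ 0) → c ∈ uIcc (leftInv φ (1 - 1 / (m : ℝ)))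
        (leftInv φ (1 - 1 / (m : ℝ)) + meanExcess φ (leftInv φ (1 - 1 / (m : ℝ))) * x) ∧
        (-Real.log (∫ t in Ioi (leftInv φ (1 - 1 / (m : ℝ)) +
          meanExcess φ (leftInv φ (1 - 1 / (m : ℝ))) * x), (1 - φ t))) -
        (-Real.log (∫ t in Ioi (leftInv φ (1 - 1 / (m : ℝ))), (1 - φ t))) =
        meanExcess φ (leftInv φ (1 - 1 / (m : ℝ))) / meanExcess φ c * x := by
      intro m
      by_cases hm : ∀ w ∈ uIcc (leftInv φ (1 - 1 / (m : ℝ)))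
          (leftInv φ (1 - 1 / (m : ℝ)) + meanExcess φ (leftInv φ (1 - 1 / (m : ℝ))) * x),
          HasDerivAt (fun z => -Real.log (∫ t in Ioi z, (1 - φ t))) (meanExcess φ w)⁻¹ w ∧
            (meanExcess φ w)⁻¹ ≠ 0
      · obtain ⟨c, hc, e⟩ := exists_mem_uIcc_ratio (fun w hw => (hm w hw).1)
          (fun w _ => hasDerivAt_id w)
        refine ⟨c, fun _ => ⟨hc, ?_⟩⟩
        rw [mul_one] at e
        rw [← e]
        simp only [id]
        ring
      · exact ⟨0, fun h => absurd h hm⟩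
    choose c hc using hex
    have hlim := (tendsto_meanExcess_ratio h hv x ht
      (hP.mono fun m hm => (hc m hm).1)).mul_const x
    rw [one_mul] at hlim
    refine hlim.congr' ?_
    filter_upwards [hP] with m hm using ((hc m hm).2).symm
  · exact tendsto_meanExcess_ratio h hv x ht (Eventually.of_forall fun m => right_mem_uIcc)

end Gumbel

/-- Under the von Mises conditions the normalised marginal tails and their derivatives converge. -/
theorem tendsto_marginTail {d : ℕ} {F : Measure (Fin d → ℝ)} {ty : MarginType d}
    (hty : ty.ShapePos) {j : Fin d} (h : SmoothCDF (margCDF F j))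
    (hv : VonMises ty j (margCDF F j)) :
    (∀ᶠ m in atTop, 0 < normScale F ty m j) ∧ ∀ x ∈ marginSupp ty,
      Tendsto (fun m : ℕ => (m : ℝ) *
        (1 - margCDF F j (normScale F ty m j * x + normLoc F ty m j))) atTop
        (𝓝 (marginTail ty j x)) ∧
      Tendsto (fun m : ℕ => (m : ℝ) * (normScale F ty m j *
        deriv (margCDF F j) (normScale F ty m j * x + normLoc F ty m j))) atTop
        (𝓝 (marginTailDeriv ty j x)) := by
  cases ty with
  | frechet ρ => exact tendsto_frechet h (hty j) hv.1
  | weibull ω => exact tendsto_weibull h hv.1 hv.2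
  | gumbel =>
    obtain ⟨h1, h2⟩ := tendsto_gumbel h hv
    exact ⟨h1, fun x _ => h2 x⟩

end MaxStable

/-! ### Densities in coordinates given by the marginal tails -/

namespace MaxStable

lemma measurable_indicator_ofReal {ι : Type*} [Fintype ι] {U : Set (ι → ℝ)} (hU : IsOpen U)
    {f : (ι → ℝ) → ℝ} (hf : ContinuousOn f U) :
    Measurable (U.indicator fun v => ENNReal.ofReal (f v)) := by
  classical
  rw [← piecewise_eq_indicator]
  exact (ENNReal.continuous_ofReal.comp_continuousOn hf).measurable_piecewise
    continuousOn_const hU.measurableSet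

/-- The image of the law `P` under coordinatewise antitone maps `y i` with a smooth survival
function `f` there has a density, and so has `P` itself. The last conjunct says that the Jacobian
factor pushes forward to at most Lebesgue measure. -/
theorem density_of_survival {ι : Type*} [Fintype ι] [DecidableEq ι] {S V : ι → Set ℝ}
    (hS : ∀ i, MeasurableSet (S i)) {y y' : ι → ℝ → ℝ} (hy : ∀ i, Measurable (y i))
    (hy' : ∀ i, Measurable (y' i)) (hderiv : ∀ i, ∀ x ∈ S i, HasDerivAt (y i) (y' i x) x)
    (hanti : ∀ i, AntitoneOn (y i) (S i)) (himg : ∀ i, y i '' S i = V i)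
    (hV : ∀ i, IsOpen (V i)) {P : Measure (ι → ℝ)} [IsFiniteMeasure P]
    (hPS : ∀ᵐ x ∂P, ∀ i, x i ∈ S i) {f : (ι → ℝ) → ℝ} {l : List ι} (hl : l.Nodup)
    (hmem : ∀ i, i ∈ l) (hf : ContDiffOn ℝ l.length f (pi univ V))
    (hsurv : ∀ v ∈ pi univ V, P.real {x | ∀ i, v i ≤ y i (x i)} = f v) :
    P.map (fun x i => y i (x i)) = volume.withDensity
        ((pi univ V).indicator fun v => ENNReal.ofReal (negPartials l f v)) ∧
      P = volume.withDensity (fun x =>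
        (pi univ V).indicator (fun v => ENNReal.ofReal (negPartials l f v)) (fun i => y i (x i)) *
          ∏ i, (S i).indicator (fun x => ENNReal.ofReal (-y' i x)) (x i)) ∧
      (volume.withDensity fun x : ι → ℝ =>
        ∏ i, (S i).indicator (fun x => ENNReal.ofReal (-y' i x)) (x i)).map
          (fun x i => y i (x i)) ≤ volume := by
  have hU : IsOpen (pi univ V) := isOpen_set_pi finite_univ fun i _ => hV i
  set K := (pi univ V).indicator fun v => ENNReal.ofReal (negPartials l f v) with hKdef
  have hK : Measurable K := measurable_indicator_ofReal hU (continuousOn_negPartials hU l hf)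
  have hY : Measurable fun (x : ι → ℝ) i => y i (x i) :=
    measurable_pi_lambda _ fun i => (hy i).comp (measurable_pi_apply i)
  have hq : ∀ i, Measurable ((S i).indicator fun x => ENNReal.ofReal (-y' i x)) := fun i =>
    ((hy' i).neg.ennreal_ofReal).indicator (hS i)
  have hsf : ∀ i, SigmaFinite ((volume : Measure ℝ).withDensity
      ((S i).indicator fun x => ENNReal.ofReal (-y' i x))) := fun i =>
    SigmaFinite.withDensity_of_ne_top (ae_of_all _ fun x => by
      by_cases hx : x ∈ S i <;> simp [hx])
  have hρ : ∀ i, ((volume : Measure ℝ).withDensity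
      ((S i).indicator fun x => ENNReal.ofReal (-y' i x))).map (y i)
        = volume.restrict (V i) := fun i => by
    rw [map_withDensity_neg_deriv (hS i) (hy i) (hderiv i) (hanti i), himg]
  have hρS : ∀ i, (volume : Measure ℝ).withDensity
      ((S i).indicator fun x => ENNReal.ofReal (-y' i x)) (S i)ᶜ = 0 := fun i => by
    rw [withDensity_apply _ (hS i).compl, setLIntegral_congr_fun (g := fun _ => 0) (hS i).compl
      fun x hx => indicator_of_notMem hx _]
    simp
  have hpi : (Measure.pi fun i => (volume : Measure ℝ).withDensity
      ((S i).indicator fun x => ENNReal.ofReal (-y' i x))) = volume.withDensity fun x : ι → ℝ =>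
        ∏ i, (S i).indicator (fun x => ENNReal.ofReal (-y' i x)) (x i) :=
    pi_withDensity (fun _ => volume) hq
  have hrestr : (Measure.pi fun i => (volume : Measure ℝ).restrict (V i))
      = volume.restrict (pi univ V) := (Measure.restrict_pi_pi _ _).symm
  have hKr : (volume.restrict (pi univ V)).withDensity K = volume.withDensity K := by
    rw [← withDensity_indicator hU.measurableSet, hKdef, indicator_indicator, inter_self]
  have hmapU : ∀ᵐ v ∂P.map fun x i => y i (x i), v ∈ pi univ V := by
    refine (ae_map_iff (p := fun v => v ∈ pi univ V) hY.aemeasurable hU.measurableSet).mpr ?_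
    filter_upwards [hPS] with x hx i _
    exact himg i ▸ mem_image_of_mem _ (hx i)
  have hmap : P.map (fun x i => y i (x i)) = volume.withDensity K := by
    have h := restrict_eq_withDensity_negPartials hU (μ := P.map fun x i => y i (x i)) (f := f)
      (fun v hv => by
        rw [map_measureReal_apply hY measurableSet_Ici, ← hsurv v hv]
        rfl) l hl hmem hf hK (fun x hx => indicator_of_mem hx _)
    rw [Measure.restrict_eq_self_of_ae_mem hmapU, restrict_withDensity hU.measurableSet,
      hKr] at h
    exact h
  refine ⟨hmap, ?_, ?_⟩
  · have h := eq_withDensity_comp hS hy hanti hρS hρ hPS hK (by rw [hmap, hrestr, hKr])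
    have hprod : Measurable fun x : ι → ℝ =>
        ∏ i, (S i).indicator (fun x => ENNReal.ofReal (-y' i x)) (x i) :=
      Finset.measurable_prod _ fun i _ => (hq i).comp (measurable_pi_apply i)
    rw [hpi] at h
    refine (h.trans (withDensity_mul volume hprod (hK.comp hY)).symm).trans
      (congrArg _ (funext fun x => ?_))
    rw [Pi.mul_apply, mul_comm]
    rfl
  · have : ∀ i, SigmaFinite (((volume : Measure ℝ).withDensity
        ((S i).indicator fun x => ENNReal.ofReal (-y' i x))).map (y i)) := fun i => by
      rw [hρ i]; infer_instance
    rw [← hpi, Measure.pi_map_pi fun i => (hy i).aemeasurable]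
    simp_rw [hρ]
    rw [hrestr]
    exact Measure.restrict_le_self

/-! ### The margins of a max-stable law -/

section MaxStableLaw

variable {d : ℕ} {ty : MarginType d}

lemma measurableSet_marginSupp : MeasurableSet (marginSupp ty) := by
  cases ty <;> simp [marginSupp]

lemma marginDF_eq_exp {j : Fin d} {x : ℝ} (hx : x ∈ marginSupp ty) :
    marginDF ty j x = Real.exp (-marginTail ty j x) := by
  cases ty with
  | frechet ρ => exact if_pos hx
  | weibull ω => exact if_pos hx
  | gumbel => rfl

lemma measurable_marginTail (j : Fin d) : Measurable (marginTail ty j) := by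
  cases ty with
  | frechet ρ => exact measurable_id.pow_const _
  | weibull ω => exact measurable_id.neg.pow_const _
  | gumbel => exact Real.measurable_exp.comp measurable_id.neg

lemma measurable_marginTailDeriv (j : Fin d) : Measurable (marginTailDeriv ty j) := by
  cases ty with
  | frechet ρ => exact (measurable_id.pow_const _).const_mul _
  | weibull ω => exact (measurable_id.neg.pow_const _).const_mul _
  | gumbel => exact Real.measurable_exp.comp measurable_id.neg

lemma hasDerivAt_marginTail (j : Fin d) {x : ℝ} (hx : x ∈ marginSupp ty) :
    HasDerivAt (marginTail ty j) (-marginTailDeriv ty j x) x := by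
  cases ty with
  | frechet ρ =>
    have := Real.hasDerivAt_rpow_const (p := -ρ j) (Or.inl (ne_of_gt hx))
    change HasDerivAt (fun x => x ^ (-ρ j)) _ x
    simpa [marginTailDeriv] using this
  | weibull ω =>
    have hx' : -x ≠ 0 := neg_ne_zero.mpr (ne_of_lt hx)
    have := (Real.hasDerivAt_rpow_const (p := ω j) (Or.inl hx')).comp x (hasDerivAt_neg x)
    change HasDerivAt (fun x => (-x) ^ ω j) _ x
    simpa [marginTailDeriv, Function.comp_def] using this
  | gumbel =>
    have := (Real.hasDerivAt_exp (-x)).comp x (hasDerivAt_neg x)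
    change HasDerivAt (fun x => Real.exp (-x)) _ x
    simpa [marginTailDeriv, Function.comp_def] using this

lemma marginTail_pos (j : Fin d) {x : ℝ} (hx : x ∈ marginSupp ty) : 0 < marginTail ty j x := by
  cases ty with
  | frechet ρ => exact Real.rpow_pos_of_pos hx _
  | weibull ω => exact Real.rpow_pos_of_pos (neg_pos.mpr hx) _
  | gumbel => exact Real.exp_pos _

lemma strictAntiOn_marginTail (hty : ty.ShapePos) (j : Fin d) :
    StrictAntiOn (marginTail ty j) (marginSupp ty) := by
  cases ty with
  | frechet ρ =>
    exact fun x hx z _ hxz => Real.rpow_lt_rpow_of_neg hx hxz (neg_lt_zero.mpr (hty j))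
  | weibull ω =>
    exact fun x _ z hz hxz => Real.rpow_lt_rpow (neg_pos.mpr hz).le (neg_lt_neg hxz) (hty j)
  | gumbel => exact fun x _ z _ hxz => Real.exp_lt_exp.mpr (neg_lt_neg hxz)

lemma exists_marginTail_eq (hty : ty.ShapePos) (j : Fin d) {v : ℝ} (hv : 0 < v) :
    ∃ x ∈ marginSupp ty, marginTail ty j x = v := by
  cases ty with
  | frechet ρ =>
    refine ⟨v ^ (-(ρ j)⁻¹), Real.rpow_pos_of_pos hv _, ?_⟩
    have := (hty j).ne'
    simp only [marginTail]
    rw [← Real.rpow_mul hv.le, neg_mul_neg, inv_mul_cancel₀ this, Real.rpow_one]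
  | weibull ω =>
    refine ⟨-v ^ (ω j)⁻¹, neg_lt_zero.mpr (Real.rpow_pos_of_pos hv _), ?_⟩
    have := (hty j).ne'
    simp only [marginTail]
    rw [neg_neg, ← Real.rpow_mul hv.le, inv_mul_cancel₀ this, Real.rpow_one]
  | gumbel => exact ⟨-Real.log v, mem_univ _, by simp [marginTail, Real.exp_log hv]⟩

lemma image_marginTail (hty : ty.ShapePos) (j : Fin d) :
    marginTail ty j '' marginSupp ty = Ioi 0 := by
  ext v
  constructor
  · rintro ⟨x, hx, rfl⟩
    exact marginTail_pos j hx
  · intro hv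
    obtain ⟨x, hx, hxv⟩ := exists_marginTail_eq hty j (mem_Ioi.mp hv)
    exact ⟨x, hx, hxv⟩

variable {H : Measure (stdSimplex ℝ (Fin d))} {G : Measure (Fin d → ℝ)}

lemma maxStableDF_eq_exp {x : Fin d → ℝ} (hx : ∀ j, x j ∈ marginSupp ty) :
    maxStableDF H ty x = Real.exp (-stableTail H fun j => marginTail ty j (x j)) := by
  have h1 : ∀ j, marginDF ty j (x j) = Real.exp (-marginTail ty j (x j)) := fun j =>
    marginDF_eq_exp (hx j)
  simp [maxStableDF, evCopula, h1, Real.exp_pos]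

lemma stableTail_const_le [IsProbabilityMeasure H] {δ : ℝ} (hδ : 0 ≤ δ) :
    stableTail H (fun _ => δ) ≤ d * δ := by
  rw [stableTail]
  gcongr
  calc ∫ w, (⨆ j : Fin d, (w : Fin d → ℝ) j * δ) ∂H ≤ ∫ _, δ ∂H := by
        refine integral_mono_of_nonneg (ae_of_all _ fun w => ?_) (integrable_const δ)
          (ae_of_all _ fun w => ?_)
        · exact Real.iSup_nonneg fun j => mul_nonneg (w.2.1 j) hδ
        · refine Real.iSup_le (fun j => ?_) hδ
          have : (w : Fin d → ℝ) j ≤ 1 := by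
            rw [← w.2.2]
            exact Finset.single_le_sum (fun i _ => w.2.1 i) (Finset.mem_univ j)
          exact mul_le_of_le_one_left hδ this
    _ = δ := by simp

/-- A max-stable law is carried by the points at which all margins lie in `(0, 1)`. -/
lemma IsMaxStableLaw.ae_mem_marginSupp [IsProbabilityMeasure H] [IsProbabilityMeasure G]
    (hG : IsMaxStableLaw H ty G) (hty : ty.ShapePos) : ∀ᵐ x ∂G, ∀ j, x j ∈ marginSupp ty := by
  cases ty with
  | gumbel => exact ae_of_all _ fun x j => mem_univ _
  | frechet ρ =>
    -- A half-space `x j ≤ 0` is a countable union of lower orthants on which `G` vanishes.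
    refine ae_all_iff.mpr fun j => ?_
    have hnull : ∀ N : ℕ, G (Iic fun i => if i = j then 0 else (N : ℝ)) = 0 := fun N => by
      rw [← measureReal_eq_zero_iff, hG]
      have : ¬ ∀ i, 0 < marginDF (.frechet ρ) i (if i = j then 0 else (N : ℝ)) := fun h => by
        simpa [marginDF] using h j
      exact if_neg this
    refine measure_mono_null (fun x hx => ?_) (measure_iUnion_null hnull)
    have hx' : x j ≤ 0 := not_lt.mp hx
    obtain ⟨N, hN⟩ := exists_nat_ge (∑ i, |x i|)
    refine mem_iUnion.mpr ⟨N, fun i => ?_⟩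
    by_cases hij : i = j
    · subst hij; simpa using hx'
    · simp only [hij, if_false]
      exact (le_abs_self _).trans ((Finset.single_le_sum (f := fun i => |x i|)
        (fun i _ => abs_nonneg _) (Finset.mem_univ i)).trans hN)
  | weibull ω =>
    have hm : MeasurableSet {x : Fin d → ℝ | ∀ j, x j ∈ Iio (0 : ℝ)} := by
      have : {x : Fin d → ℝ | ∀ j, x j ∈ Iio (0 : ℝ)} = pi univ fun _ => Iio 0 := by
        ext; simp
      rw [this]
      exact MeasurableSet.univ_pi fun _ => measurableSet_Iio
    -- The mass of the negative orthant is at least `G x` for every `x < 0`, and `G x` tends to `1`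
    -- along the points `x` with all marginal tails equal to `δ → 0`.
    have hge : ∀ δ : ℝ, 0 < δ →
        Real.exp (-(d * δ)) ≤ G.real {x : Fin d → ℝ | ∀ j, x j ∈ Iio (0 : ℝ)} := by
      intro δ hδ
      choose x hx hxδ using fun j => exists_marginTail_eq (ty := .weibull ω) hty j hδ
      have h1 := hG x
      rw [maxStableDF_eq_exp hx] at h1
      simp_rw [hxδ] at h1
      calc Real.exp (-(d * δ)) ≤ G.real (Iic x) := by
            rw [h1]
            exact Real.exp_le_exp.mpr (neg_le_neg (stableTail_const_le hδ.le))
        _ ≤ _ := measureReal_mono fun z hz j => (hz j).trans_lt (hx j)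
    have hone : 1 ≤ G.real {x : Fin d → ℝ | ∀ j, x j ∈ Iio (0 : ℝ)} := by
      have hlim : Tendsto (fun δ : ℝ => Real.exp (-(d * δ))) (𝓝[>] 0) (𝓝 1) := by
        have : Continuous fun δ : ℝ => Real.exp (-(d * δ)) := by fun_prop
        simpa using (this.tendsto 0).mono_left nhdsWithin_le_nhds
      exact le_of_tendsto hlim (eventually_nhdsWithin_of_forall hge)
    have : G {x : Fin d → ℝ | ∀ j, x j ∈ Iio (0 : ℝ)} = 1 := by
      rw [← ofReal_measureReal, le_antisymm measureReal_le_one hone, ENNReal.ofReal_one]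
    exact (prob_compl_eq_zero_iff hm).mpr this

lemma IsMaxStableLaw.survival [IsProbabilityMeasure H] [IsProbabilityMeasure G]
    (hG : IsMaxStableLaw H ty G) (hty : ty.ShapePos) {v : Fin d → ℝ} (hv : ∀ j, 0 < v j) :
    G.real {x | ∀ j, v j ≤ marginTail ty j (x j)} = Real.exp (-stableTail H v) := by
  choose x hx hxv using fun j => exists_marginTail_eq hty j (hv j)
  have h1 := hG x
  rw [maxStableDF_eq_exp hx] at h1
  simp_rw [hxv] at h1
  rw [← h1]
  refine measureReal_congr ?_
  filter_upwards [hG.ae_mem_marginSupp hty] with z hz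
  refine propext (forall_congr' fun j => ?_)
  rw [← hxv j]
  exact (strictAntiOn_marginTail hty j).le_iff_ge (hx j) (hz j)

end MaxStableLaw

end MaxStable

/-! ### The law of a normalised block maximum -/

namespace MaxStable

section BlockMaximum

variable {d : ℕ} {F : Measure (Fin d → ℝ)} {ty : MarginType d} {m : ℕ}

lemma margCDF_eq_cdf [IsProbabilityMeasure F] (j : Fin d) :
    margCDF F j = ProbabilityTheory.cdf (F.map fun z => z j) := by
  have : IsProbabilityMeasure (F.map fun z => z j) :=
    Measure.isProbabilityMeasure_map (measurable_pi_apply j).aemeasurable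
  ext t
  rw [ProbabilityTheory.cdf_eq_real,
    map_measureReal_apply (measurable_pi_apply j) measurableSet_Iic]
  rfl

lemma smoothCDF_margCDF [IsProbabilityMeasure F] {j : Fin d} (hc : Continuous (margCDF F j))
    (hs : ContDiffOn ℝ 1 (margCDF F j) {z | 0 < margCDF F j z ∧ margCDF F j z < 1}) :
    SmoothCDF (margCDF F j) where
  mono := by rw [margCDF_eq_cdf]; exact ProbabilityTheory.monotone_cdf _
  cont := hc
  tendsto_bot := by rw [margCDF_eq_cdf]; exact ProbabilityTheory.tendsto_cdf_atBot _
  tendsto_top := by rw [margCDF_eq_cdf]; exact ProbabilityTheory.tendsto_cdf_atTop _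
  smooth := hs

lemma measureReal_margCDF_le {j : Fin d} (h : SmoothCDF (margCDF F j)) {u : ℝ} (h0 : 0 < u)
    (h1 : u < 1) : F.real {z | margCDF F j (z j) ≤ u} = u := by
  obtain ⟨t, ht, hle⟩ := h.exists_le_iff h0 h1
  simp_rw [hle]
  exact ht

lemma ae_margCDF_mem_Ioo [IsProbabilityMeasure F] {j : Fin d} (h : SmoothCDF (margCDF F j)) :
    ∀ᵐ z ∂F, 0 < margCDF F j (z j) ∧ margCDF F j (z j) < 1 := by
  have hm : Measurable fun z : Fin d → ℝ => margCDF F j (z j) :=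
    h.cont.measurable.comp (measurable_pi_apply j)
  refine Filter.Eventually.and ?_ ?_
  · have h0 : F.real {z | margCDF F j (z j) ≤ 0} ≤ 0 := by
      refine ge_of_tendsto
        (tendsto_id.mono_left nhdsWithin_le_nhds : Tendsto id (𝓝[>] (0 : ℝ)) _) ?_
      filter_upwards [Ioo_mem_nhdsGT (zero_lt_one' ℝ)] with u hu
      refine le_trans ?_ (measureReal_margCDF_le h hu.1 hu.2).le
      exact measureReal_mono fun z (hz : margCDF F j (z j) ≤ 0) => hz.trans hu.1.le
    have h1 : F {z | margCDF F j (z j) ≤ 0} = 0 :=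
      (measureReal_eq_zero_iff).mp (le_antisymm h0 measureReal_nonneg)
    refine measure_mono_null (fun z hz => ?_) h1
    exact not_lt.mp (show ¬ 0 < margCDF F j (z j) from hz)
  · have h1 : 1 ≤ F.real {z | margCDF F j (z j) < 1} := by
      refine le_of_tendsto
        (tendsto_id.mono_left nhdsWithin_le_nhds : Tendsto id (𝓝[<] (1 : ℝ)) _) ?_
      filter_upwards [Ioo_mem_nhdsLT (zero_lt_one' ℝ)] with u hu
      calc id u = F.real {z | margCDF F j (z j) ≤ u} := (measureReal_margCDF_le h hu.1 hu.2).symm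
        _ ≤ _ := measureReal_mono fun z hz => lt_of_le_of_lt hz hu.2
    have : F {z | margCDF F j (z j) < 1} = 1 := by
      rw [← ofReal_measureReal, le_antisymm measureReal_le_one h1, ENNReal.ofReal_one]
    exact (prob_compl_eq_zero_iff (measurableSet_lt hm measurable_const)).mpr this

variable (F ty m)

/-- The tail function `x ↦ m (1 - F_j(a_m x + b_m))` of the normalised observations, the analogue
of `marginTail` for block size `m`. -/
def blockTail (j : Fin d) (x : ℝ) : ℝ :=
  (m : ℝ) * (1 - margCDF F j (normScale F ty m j * x + normLoc F ty m j))

/-- The negated derivative of `blockTail`. -/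
def blockTailDeriv (j : Fin d) (x : ℝ) : ℝ :=
  (m : ℝ) * (normScale F ty m j *
    deriv (margCDF F j) (normScale F ty m j * x + normLoc F ty m j))

/-- The points at which the `j`-th normalised margin lies strictly between `0` and `1`. -/
def blockSupp (j : Fin d) : Set ℝ :=
  {x | 0 < margCDF F j (normScale F ty m j * x + normLoc F ty m j) ∧
    margCDF F j (normScale F ty m j * x + normLoc F ty m j) < 1}

lemma measurable_normMax : Measurable (normMax F ty m) :=
  measurable_pi_lambda _ fun j => ((Measurable.iSup fun k =>
    (measurable_pi_apply j).comp (measurable_pi_apply k)).sub_const _).div_const _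

instance [IsProbabilityMeasure F] : IsProbabilityMeasure (normMaxLaw F ty m) :=
  Measure.isProbabilityMeasure_map (measurable_normMax F ty m).aemeasurable

lemma jointMaxLaw_eq_pi [IsProbabilityMeasure F] (n : ℕ) :
    jointMaxLaw F ty n m = Measure.pi fun _ : Fin n => normMaxLaw F ty m :=
  Measure.pi_map_pi fun _ => (measurable_normMax F ty m).aemeasurable

variable {F ty m}

lemma measurable_blockTail {j : Fin d} (h : SmoothCDF (margCDF F j)) :
    Measurable (blockTail F ty m j) :=
  ((h.cont.measurable.comp ((measurable_id.const_mul _).add_const _)).const_sub _).const_mul _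

lemma measurable_blockTailDeriv (j : Fin d) : Measurable (blockTailDeriv F ty m j) :=
  (((measurable_deriv _).comp ((measurable_id.const_mul _).add_const _)).const_mul _).const_mul _

lemma measurableSet_blockSupp {j : Fin d} (h : SmoothCDF (margCDF F j)) :
    MeasurableSet (blockSupp F ty m j) := by
  have : Measurable fun x => margCDF F j (normScale F ty m j * x + normLoc F ty m j) :=
    h.cont.measurable.comp ((measurable_id.const_mul _).add_const _)
  exact (measurableSet_lt measurable_const this).inter (measurableSet_lt this measurable_const)

lemma hasDerivAt_blockTail {j : Fin d} (h : SmoothCDF (margCDF F j)) {x : ℝ}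
    (hx : x ∈ blockSupp F ty m j) :
    HasDerivAt (blockTail F ty m j) (-blockTailDeriv F ty m j x) x := by
  have h1 : HasDerivAt (fun x => normScale F ty m j * x + normLoc F ty m j)
      (normScale F ty m j) x := by
    simpa using ((hasDerivAt_id x).const_mul (normScale F ty m j)).add_const (normLoc F ty m j)
  have h2 := (((h.hasDerivAt hx.1 hx.2).comp x h1).const_sub 1).const_mul (m : ℝ)
  convert! h2 using 1
  rw [blockTailDeriv]
  ring

lemma antitone_blockTail {j : Fin d} (h : SmoothCDF (margCDF F j))
    (ha : 0 < normScale F ty m j) : Antitone (blockTail F ty m j) := by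
  intro x x' hx
  have := h.mono (add_le_add_left (mul_le_mul_of_nonneg_left hx ha.le) (normLoc F ty m j))
  exact mul_le_mul_of_nonneg_left (by linarith) (Nat.cast_nonneg m)

lemma one_sub_div_mem_Ioo {v : ℝ} (hv : v ∈ Ioo (0 : ℝ) m) :
    1 - v / (m : ℝ) ∈ Ioo (0 : ℝ) 1 := by
  have hm : (0 : ℝ) < m := hv.1.trans hv.2
  have h1 : v / m < 1 := (div_lt_one hm).mpr hv.2
  have h2 : 0 < v / m := div_pos hv.1 hm
  exact ⟨by linarith, by linarith⟩

lemma image_blockTail {j : Fin d} (h : SmoothCDF (margCDF F j)) (ha : 0 < normScale F ty m j)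
    (hm : 0 < m) : blockTail F ty m j '' blockSupp F ty m j = Ioo (0 : ℝ) m := by
  have hm' : (0 : ℝ) < m := by exact_mod_cast hm
  ext v
  constructor
  · rintro ⟨x, hx, rfl⟩
    refine ⟨mul_pos hm' (by linarith [hx.2]), ?_⟩
    calc blockTail F ty m j x < m * 1 := mul_lt_mul_of_pos_left (by linarith [hx.1]) hm'
      _ = m := mul_one _
  · intro hv
    have hu := one_sub_div_mem_Ioo hv
    obtain ⟨t, ht⟩ := h.exists_eq hu.1 hu.2
    have hx : normScale F ty m j * ((t - normLoc F ty m j) / normScale F ty m j)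
        + normLoc F ty m j = t := by
      field_simp; ring
    refine ⟨(t - normLoc F ty m j) / normScale F ty m j, ?_, ?_⟩
    · simp only [blockSupp, mem_ofPred_eq, hx, ht]
      exact hu
    · simp only [blockTail, hx, ht]
      field_simp; ring

lemma normScale_mul_normMax_add {j : Fin d} (ha : 0 < normScale F ty m j)
    (z : Fin m → Fin d → ℝ) :
    normScale F ty m j * normMax F ty m z j + normLoc F ty m j = ⨆ k, z k j := by
  rw [normMax]
  field_simp
  ring

/-- Away from a null set, the normalised maximum lies in the region where its margins are
smooth. -/
lemma ae_normMaxLaw_mem_blockSupp [IsProbabilityMeasure F]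
    (h : ∀ j, SmoothCDF (margCDF F j))
    (ha : ∀ j, 0 < normScale F ty m j) (hm : 0 < m) :
    ∀ᵐ x ∂normMaxLaw F ty m, ∀ j, x j ∈ blockSupp F ty m j := by
  have : Nonempty (Fin m) := ⟨⟨0, hm⟩⟩
  refine ae_all_iff.mpr fun j => ?_
  refine (ae_map_iff (p := fun x : Fin d → ℝ => x j ∈ blockSupp F ty m j)
    (measurable_normMax F ty m).aemeasurable
    (measurable_pi_apply j (measurableSet_blockSupp (h j)))).mpr ?_
  have hae : ∀ᵐ z ∂Measure.pi fun _ : Fin m => F, ∀ k,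
      0 < margCDF F j (z k j) ∧ margCDF F j (z k j) < 1 :=
    ae_all_iff.mpr fun k =>
      (Measure.quasiMeasurePreserving_eval (fun _ : Fin m => F) k).ae (ae_margCDF_mem_Ioo (h j))
  filter_upwards [hae] with z hz
  obtain ⟨k, hk⟩ := exists_eq_ciSup_of_finite (f := fun k => z k j)
  simp only [blockSupp, mem_ofPred_eq, normScale_mul_normMax_add (ha j), ← hk]
  exact hz k

/-- The joint survival function of the transformed normalised maximum. -/
lemma normMaxLaw_survival [IsProbabilityMeasure F]
    (h : ∀ j, SmoothCDF (margCDF F j)) (ha : ∀ j, 0 < normScale F ty m j)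
    (hm : 0 < m) {C : (Fin d → ℝ) → ℝ}
    (hC : ∀ z : Fin d → ℝ, F.real (Iic z) = C fun j => margCDF F j (z j)) {v : Fin d → ℝ}
    (hv : ∀ j, v j ∈ Ioo (0 : ℝ) m) :
    (normMaxLaw F ty m).real {x | ∀ j, v j ≤ blockTail F ty m j (x j)}
      = C (fun j => 1 - v j / (m : ℝ)) ^ m := by
  have : Nonempty (Fin m) := ⟨⟨0, hm⟩⟩
  have hm' : (0 : ℝ) < m := by exact_mod_cast hm
  choose t ht htle using fun j => (h j).exists_le_iff (one_sub_div_mem_Ioo (hv j)).1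
    (one_sub_div_mem_Ioo (hv j)).2
  have hmeas : MeasurableSet {x : Fin d → ℝ | ∀ j, v j ≤ blockTail F ty m j (x j)} := by
    simp only [ofPred_forall]
    exact MeasurableSet.iInter fun j => measurableSet_le measurable_const
      ((measurable_blockTail (h j)).comp (measurable_pi_apply j))
  have hpre : normMax F ty m ⁻¹' {x | ∀ j, v j ≤ blockTail F ty m j (x j)}
      = pi univ fun _ => Iic t := by
    ext z
    have key : ∀ j, v j ≤ blockTail F ty m j (normMax F ty m z j) ↔ ∀ k, z k j ≤ t j := fun j => by
      rw [blockTail, normScale_mul_normMax_add (ha j), ← ciSup_le_iff (finite_range _).bddAbove,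
        ← htle j, ← div_le_iff₀' hm']
      constructor <;> intro hle <;> linarith
    simp only [mem_preimage, mem_ofPred_eq, key, mem_univ_pi, mem_Iic, Pi.le_def]
    exact forall_comm
  rw [normMaxLaw, map_measureReal_apply (measurable_normMax F ty m) hmeas, hpre, measureReal_def,
    Measure.pi_pi]
  simp only [Finset.prod_const, Finset.card_univ, Fintype.card_fin, ENNReal.toReal_pow]
  rw [← measureReal_def, hC]
  simp_rw [ht]

/-- The survival function of a single transformed observation is smooth on `(0, m)^d`. The
block size `m = 0` is harmless: the domain is then empty unless `d = 0`. -/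
lemma contDiffOn_copula_tail {C : (Fin d → ℝ) → ℝ}
    (hC : ContDiffOn ℝ d C {u | ∀ j, u j ∈ Ioo (0 : ℝ) 1}) (m : ℕ) :
    ContDiffOn ℝ d (fun v : Fin d → ℝ => C fun j => 1 - v j / (m : ℝ))
      (pi univ fun _ => Ioo (0 : ℝ) m) := by
  have h1 : ContDiff ℝ d fun (v : Fin d → ℝ) (j : Fin d) => 1 - v j / (m : ℝ) := by fun_prop
  exact hC.comp h1.contDiffOn fun v hv j => one_sub_div_mem_Ioo (hv j (mem_univ j))

end BlockMaximum

end MaxStable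

/-! ### Convergence of the densities -/

namespace MaxStable

section Convergence

variable {d : ℕ}

/-- All coordinates, in decreasing order. -/
def coordList (d : ℕ) : List (Fin d) := (List.finRange d).reverse

lemma coordList_pairwise : (coordList d).Pairwise (· > ·) :=
  List.pairwise_reverse.mpr (List.pairwise_lt_finRange d)

lemma length_coordList : (coordList d).length = d := by simp [coordList]

lemma mem_coordList (i : Fin d) : i ∈ coordList d := by simp [coordList]

lemma nodup_coordList : (coordList d).Nodup := coordList_pairwise.imp fun h => h.ne'

lemma isOpen_pi_Ioi : IsOpen (pi univ fun _ : Fin d => Ioi (0 : ℝ)) :=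
  isOpen_set_pi finite_univ fun _ _ => isOpen_Ioi

lemma isOpen_pi_Ioo (t : ℝ) : IsOpen (pi univ fun _ : Fin d => Ioo (0 : ℝ) t) :=
  isOpen_set_pi finite_univ fun _ _ => isOpen_Ioo

lemma eventually_mem_pi_Ioo {m : ℕ → ℕ} (hm : Tendsto m atTop atTop) :
    ∀ v ∈ pi univ fun _ : Fin d => Ioi (0 : ℝ),
      ∀ᶠ n in atTop, v ∈ pi univ fun _ : Fin d => Ioo (0 : ℝ) (m n) := by
  intro v hv
  have h : ∀ j, ∀ᶠ n in atTop, v j < (m n : ℝ) := fun j =>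
    (tendsto_natCast_atTop_atTop.comp hm).eventually_gt_atTop (v j)
  filter_upwards [eventually_all.mpr h] with n hn j hj using ⟨hv j hj, hn j⟩

variable {H : Measure (stdSimplex ℝ (Fin d))} {m : ℕ → ℕ} {C : (Fin d → ℝ) → ℝ}

lemma CopulaCondition.contDiffOn_tail (h : CopulaCondition H m C) :
    ContDiffOn ℝ d (stableTail H) (pi univ fun _ => Ioi (0 : ℝ)) :=
  h.tail_smooth.mono fun _ hx j => hx j (mem_univ j)

lemma CopulaCondition.contDiffOn_exp_tail (h : CopulaCondition H m C) :
    ContDiffOn ℝ d (fun v => Real.exp (-stableTail H v)) (pi univ fun _ => Ioi (0 : ℝ)) :=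
  h.contDiffOn_tail.neg.exp

/-- The mixed partial derivatives of the survival functions of the transformed maxima converge. -/
lemma CopulaCondition.tendsto_negPartials (h : CopulaCondition H m C)
    (hm : Tendsto m atTop atTop) {v : Fin d → ℝ} (hv : v ∈ pi univ fun _ => Ioi (0 : ℝ)) :
    Tendsto (fun n => negPartials (coordList d)
        (fun v => C (fun j => 1 - v j / (m n : ℝ)) ^ m n) v) atTop
      (𝓝 (negPartials (coordList d) (fun v => Real.exp (-stableTail H v)) v)) := by
  have hc : ∀ n, ContDiffOn ℝ d (fun v : Fin d → ℝ => C fun j => 1 - v j / (m n : ℝ))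
      (pi univ fun _ => Ioo (0 : ℝ) (m n)) := fun n => contDiffOn_copula_tail h.copula_smooth _
  have hmix : MixedTendsto (pi univ fun _ => Ioi (0 : ℝ)) (coordList d)
      (fun n v => (m n : ℝ) * (C (fun j => 1 - v j / (m n : ℝ)) - 1))
      (fun v => -stableTail H v) := by
    refine mixedTendsto_of_sublists _ fun l' hl' x hx => ?_
    have hp : l'.Pairwise (· > ·) := coordList_pairwise.sublist hl'
    have hlen : ((l'.length : ℕ) : WithTop ℕ∞) ≤ d := by
      exact_mod_cast hl'.length_le.trans_eq length_coordList
    have hlim := h.tendsto l'.toFinset x fun j => hx j (mem_univ j)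
    have hneg : -mixedPartial l'.toFinset (stableTail H) x
        = mixedPartial l'.toFinset (fun x => -stableTail H x) x := by
      simp only [mixedPartial]
      rw [show (fun x => -stableTail H x) = -stableTail H from rfl, iteratedFDeriv_neg_apply]
      rfl
    rw [hneg, mixedPartial_eq_negPartials isOpen_pi_Ioi hp (h.contDiffOn_tail.neg.of_le hlen) hx]
      at hlim
    have hlim' := hlim.const_mul ((-1 : ℝ) ^ l'.length)
    have hsq : ((-1 : ℝ) ^ l'.length) * (-1) ^ l'.length = 1 := by
      rw [← mul_pow]; norm_num
    rw [← mul_assoc, hsq, one_mul] at hlim'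
    refine hlim'.congr' ?_
    filter_upwards [eventually_mem_pi_Ioo hm x hx] with n hn
    rw [mixedPartial_eq_negPartials (isOpen_pi_Ioo (m n)) hp
      (((contDiffOn_const.mul ((hc n).sub contDiffOn_const))).of_le hlen) hn, ← mul_assoc, hsq,
      one_mul]
  have := (hmix.pow_sub (fun n => isOpen_pi_Ioo (m n)) isOpen_pi_Ioi (eventually_mem_pi_Ioo hm) hm
    _ (fun n => by rw [length_coordList]; exact hc n)
    (by rw [length_coordList]; exact h.contDiffOn_tail.neg) 0).tendsto_negPartials _ hv
  simpa using this

variable {F G : Measure (Fin d → ℝ)} [IsProbabilityMeasure F] {ty : MarginType d}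

lemma VariationalCondition.smoothCDF (h : VariationalCondition F G H ty m) (j : Fin d) :
    SmoothCDF (margCDF F j) :=
  smoothCDF_margCDF (h.margin_continuous j) (h.margin_smooth j)

lemma VariationalCondition.eventually_normScale_pos (h : VariationalCondition F G H ty m)
    (hty : ty.ShapePos) (hm : Tendsto m atTop atTop) :
    ∀ᶠ n in atTop, 0 < m n ∧ ∀ j, 0 < normScale F ty (m n) j :=
  (hm.eventually_gt_atTop 0).and <| eventually_all.mpr fun j =>
    hm.eventually (tendsto_marginTail hty (h.smoothCDF j) (h.vonMises j)).1

lemma VariationalCondition.tendsto_blockTail (h : VariationalCondition F G H ty m)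
    (hty : ty.ShapePos) (hm : Tendsto m atTop atTop) (j : Fin d) {x : ℝ}
    (hx : x ∈ marginSupp ty) :
    Tendsto (fun n => blockTail F ty (m n) j x) atTop (𝓝 (marginTail ty j x)) ∧
      Tendsto (fun n => blockTailDeriv F ty (m n) j x) atTop (𝓝 (marginTailDeriv ty j x)) ∧
      ∀ᶠ n in atTop, x ∈ blockSupp F ty (m n) j := by
  have h1 := ((tendsto_marginTail hty (h.smoothCDF j) (h.vonMises j)).2 x hx).1.comp hm
  have h2 := ((tendsto_marginTail hty (h.smoothCDF j) (h.vonMises j)).2 x hx).2.comp hm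
  refine ⟨h1, h2, ?_⟩
  have hpos := marginTail_pos j hx
  filter_upwards [h1.eventually (lt_mem_nhds hpos), h1.eventually (gt_mem_nhds (lt_add_one _)),
    (tendsto_natCast_atTop_atTop (R := ℝ).comp hm).eventually_gt_atTop (marginTail ty j x + 1)]
    with n h3 h4 h5
  simp only [Function.comp_apply] at h3 h4 h5
  have hm' : (0 : ℝ) < m n := by linarith
  constructor
  · have := h4.trans h5
    by_contra hle
    nlinarith
  · by_contra hle
    nlinarith

/-- Convergence in total variation of the laws of the normalised maxima to the max-stable law, in
one-sided form. Both have densities factorising through the tail transformations `blockTail` and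
`marginTail`, which carry the survival functions to `C (1 - v / m) ^ m` and `exp (-L v)`. -/
theorem VariationalCondition.eventually_measure_le_add [IsProbabilityMeasure H]
    [IsProbabilityMeasure G] (h : VariationalCondition F G H ty m)
    (hG : IsMaxStableLaw H ty G) (hty : ty.ShapePos)
    (hm : Tendsto m atTop atTop) :
    (∀ᶠ n in atTop, normMaxLaw F ty (m n) ≪ volume) ∧ ∀ ε : ℝ≥0∞, 0 < ε →
      ∀ᶠ n in atTop, ∀ A, MeasurableSet A → G A ≤ normMaxLaw F ty (m n) A + ε := by
  obtain ⟨C, -, hC, hcop⟩ := h.copula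
  have hφ := h.smoothCDF
  have hcont : ∀ n, ContDiffOn ℝ (coordList d).length
      (fun v : Fin d → ℝ => C (fun j => 1 - v j / (m n : ℝ)) ^ m n)
      (pi univ fun _ => Ioo (0 : ℝ) (m n)) := fun n => by
    rw [length_coordList]
    exact (contDiffOn_copula_tail hcop.copula_smooth _).pow _
  have hcont₀ : ContDiffOn ℝ (coordList d).length (fun v => Real.exp (-stableTail H v))
      (pi univ fun _ => Ioi (0 : ℝ)) := by
    rw [length_coordList]
    exact hcop.contDiffOn_exp_tail
  have hdens := (h.eventually_normScale_pos hty hm).mono fun n hn =>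
    density_of_survival (P := normMaxLaw F ty (m n)) (V := fun _ => Ioo (0 : ℝ) (m n))
      (fun j => measurableSet_blockSupp (hφ j))
      (fun j => measurable_blockTail (hφ j)) (fun j => (measurable_blockTailDeriv j).neg)
      (fun j x hx => hasDerivAt_blockTail (hφ j) hx)
      (fun j => (antitone_blockTail (hφ j) (hn.2 j)).antitoneOn _)
      (fun j => image_blockTail (hφ j) (hn.2 j) hn.1) (fun j => isOpen_Ioo)
      (ae_normMaxLaw_mem_blockSupp hφ hn.2 hn.1) nodup_coordList mem_coordList (hcont n)
      (fun v hv => normMaxLaw_survival hφ hn.2 hn.1 hC fun j => hv j (mem_univ j))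
  have hdens₀ := density_of_survival (P := G) (V := fun _ => Ioi (0 : ℝ))
      (S := fun _ => marginSupp ty) (fun j => measurableSet_marginSupp)
      (fun j => measurable_marginTail j) (fun j => (measurable_marginTailDeriv j).neg)
      (fun j x hx => hasDerivAt_marginTail j hx)
      (fun j => (strictAntiOn_marginTail hty j).antitoneOn)
      (fun j => image_marginTail hty j) (fun j => isOpen_Ioi)
      (hG.ae_mem_marginSupp hty) nodup_coordList mem_coordList hcont₀
      (fun v hv => hG.survival hty fun j => hv j (mem_univ j))
  refine ⟨?_, fun ε hε => ?_⟩
  · filter_upwards [hdens] with n hn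
    rw [hn.2.1]
    exact withDensity_absolutelyContinuous _ _
  have hY₀ : Measurable fun (x : Fin d → ℝ) j => marginTail ty j (x j) :=
    measurable_pi_lambda _ fun j => (measurable_marginTail j).comp (measurable_pi_apply j)
  refine MaxStable.eventually_measure_le_add ?_ ?_ ?_ ?_ hY₀ ?_ ?_ ?_ ?_ ?_
    (hdens.mono fun n hn => hn.2.2) ?_ hdens₀.2.1 (hdens.mono fun n hn => hn.2.1) hε
  · exact fun n j => ((measurable_blockTailDeriv j).neg.neg.ennreal_ofReal).indicator
      (measurableSet_blockSupp (hφ j))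
  · exact fun j => ((measurable_marginTailDeriv j).neg.neg.ennreal_ofReal).indicator
      measurableSet_marginSupp
  · intro j x
    by_cases hx : x ∈ marginSupp ty <;> simp [hx]
  · exact fun n => measurable_pi_lambda _ fun j =>
      (measurable_blockTail (hφ j)).comp (measurable_pi_apply j)
  · exact fun n => measurable_indicator_ofReal (isOpen_pi_Ioo _)
      (continuousOn_negPartials (isOpen_pi_Ioo _) _ (hcont n))
  · exact measurable_indicator_ofReal isOpen_pi_Ioi
      (continuousOn_negPartials isOpen_pi_Ioi _ hcont₀)
  · intro v
    by_cases hv : v ∈ pi univ fun _ : Fin d => Ioi (0 : ℝ)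
    · rw [indicator_of_mem hv]; exact ENNReal.ofReal_ne_top
    · rw [indicator_of_notMem hv]; exact ENNReal.zero_ne_top
  · intro v hv
    have hvV := mem_of_indicator_ne_zero hv
    rw [indicator_of_mem hvV]
    refine (ENNReal.tendsto_ofReal (hcop.tendsto_negPartials hm hvV)).congr' ?_
    filter_upwards [eventually_mem_pi_Ioo hm v hvV] with n hn
    rw [indicator_of_mem hn]
  · have := measure_ne_top (G.map fun (x : Fin d → ℝ) j => marginTail ty j (x j)) univ
    rwa [hdens₀.1, withDensity_apply _ MeasurableSet.univ, Measure.restrict_univ] at this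
  · intro x hxK hxq
    have hxV := mem_of_indicator_ne_zero hxK
    have hxS : ∀ j, x j ∈ marginSupp ty := fun j => mem_of_indicator_ne_zero (hxq j)
    have hlim := fun j => h.tendsto_blockTail hty hm j (hxS j)
    constructor
    · have hat : ContinuousAt ((pi univ fun _ : Fin d => Ioi (0 : ℝ)).indicator fun v =>
          ENNReal.ofReal (negPartials (coordList d) (fun v => Real.exp (-stableTail H v)) v))
          (fun j => marginTail ty j (x j)) := by
        have hnhds := isOpen_pi_Ioi.mem_nhds hxV
        refine ((ENNReal.continuous_ofReal.comp_continuousOn (continuousOn_negPartials isOpen_pi_Ioi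
          (coordList d) hcont₀)).continuousAt hnhds).congr ?_
        filter_upwards [hnhds] with v hv
        rw [indicator_of_mem hv]
        rfl
      exact hat.tendsto.comp (tendsto_pi_nhds.mpr fun j => (hlim j).1)
    · intro j
      rw [indicator_of_mem (hxS j)]
      refine (ENNReal.tendsto_ofReal (hlim j).2.1.neg.neg).congr' ?_
      filter_upwards [(hlim j).2.2] with n hn
      rw [indicator_of_mem hn]
      rfl

/-- A bound on the density ratio dominates the laws of the maxima by a multiple of `G`. -/
lemma DensityRatioBounded.le_smul (h : DensityRatioBounded F G ty m)
    (hac : ∀ᶠ n in atTop, normMaxLaw F ty (m n) ≪ volume) :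
    ∃ J : ℝ≥0, ∀ᶠ n in atTop, normMaxLaw F ty (m n) ≤ J • G := by
  obtain ⟨n₀, J, hJ⟩ := h
  have hJ0 : (J : ℝ≥0∞) ≠ 0 := (pos_of_gt hJ).ne'
  refine ⟨J, ?_⟩
  filter_upwards [hac, eventually_ge_atTop n₀] with n hn hn₀
  have hle : ∀ᵐ x ∂(volume : Measure (Fin d → ℝ)),
      (normMaxLaw F ty (m n)).rnDeriv volume x ≤ J * G.rnDeriv volume x := by
    filter_upwards [ENNReal.ae_le_essSup (μ := (volume : Measure (Fin d → ℝ))) fun x =>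
      (normMaxLaw F ty (m n)).rnDeriv volume x / G.rnDeriv volume x] with x hx
    exact (ENNReal.div_le_iff_le_mul (Or.inr ENNReal.coe_ne_top) (Or.inr hJ0)).mp
      (hx.trans ((le_iSup₂_of_le n hn₀ le_rfl).trans hJ.le))
  calc normMaxLaw F ty (m n)
      = volume.withDensity ((normMaxLaw F ty (m n)).rnDeriv volume) :=
        (Measure.withDensity_rnDeriv_eq _ _ hn).symm
    _ ≤ volume.withDensity ((J : ℝ≥0∞) • G.rnDeriv volume) := withDensity_mono hle
    _ = (J : ℝ≥0∞) • volume.withDensity (G.rnDeriv volume) :=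
        withDensity_smul _ (Measure.measurable_rnDeriv _ _)
    _ ≤ (J : ℝ≥0∞) • G := by
        gcongr
        exact Measure.withDensity_rnDeriv_le _ _

end Convergence

end MaxStable

end

theorem proposition4p1 {d : ℕ}
    (F₀ : Measure (Fin d → ℝ)) [IsProbabilityMeasure F₀]
    (H₀ : Measure (stdSimplex ℝ (Fin d))) [IsProbabilityMeasure H₀]
    (hH₀ : MaxStable.IsAngular H₀)
    (ty : MaxStable.MarginType d) (hty : ty.ShapePos)
    (G : Measure (Fin d → ℝ)) [IsProbabilityMeasure G]
    (hG : MaxStable.IsMaxStableLaw H₀ ty G)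
    (m : ℕ → ℕ) (hm : Tendsto m atTop atTop)
    (hstrong : MaxStable.VariationalCondition F₀ G H₀ ty m)
    (hratio : MaxStable.DensityRatioBounded F₀ G ty m) :
    ∀ c : ℝ, 0 < c → ∀ c' ∈ Ioo (0 : ℝ) 1,
      MaxStable.RemotelyContiguous
        (fun n => MaxStable.jointMaxLaw F₀ ty n (m n))
        (fun n => Measure.pi fun _ : Fin n => G)
        (fun n => Real.exp (-c * (n : ℝ)))
        (fun n => (n : ℝ) ^ (-1 - c')) := by
  intro c hc c' _
  obtain ⟨hac, htv⟩ := hstrong.eventually_measure_le_add hG hty hm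
  obtain ⟨J, hJ⟩ := hratio.le_smul hac
  simp_rw [MaxStable.jointMaxLaw_eq_pi]
  exact MaxStable.remotelyContiguous_pi hJ htv hc _
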